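/- Let $G$ be a finite simple graph with $v$ vertices and $E$ edges which is square-cordial (every 4-cycle of $G$ has a diagonal), connected, and such that every edge of $G$ lies on a 3-cycle. Definitions. - $X_\Delta$ is the cell complex obtained from $G$ by identifying all vertices and adding, for every 3-cycle with coherently oriented edges $\vec e_1,\vec e_2,\vec e_3$, two 2-cells, along $2\vec e_3-\vec e_2-\vec e_1$ and $2\vec e_1-\vec e_3-\vec e_2$. $\hat X_3$ is the cell complex obtained from $G$ by adding a 2-cell along every 3-cycle. - $G_\Delta$ is the graph whose vertices are the 3-cycles of $G$, two of them being adjacent when they share an edge; $p_0(G_\Delta)$ is the number of its components. A component of $G_\Delta$ is coherent if the relations $\vec e_i=\vec e_j=\vec e_k$, for all coherently oriented triangles of the component (in both directions), never lead to a relation $\overrightarrow{e}=\overleftarrow{e}$. Let $c$ be the number of coherent components. - $t_k$ is the number of unordered triples of distinct vertices of $G$ that span exactly $k$ edges, and $d_2$ is the number of ordered pairs of vertices at distance $2$. - $\mathcal A_3=\mathbb Z[x]/(x^3)$ with $\deg x=1$, and $H^{i,j}_{\mathcal A_3}(G)$ is the degree-$j$ part of the $i$-th cohomology of the complex $C^i(G)=\bigoplus_{s\subseteq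 E(G),\,|s|=i}\mathcal A_3^{\otimes k(s)}$, where $k(s)$ is the number of components of the spanning subgraph $[G:s]$ with edge set $s$. The differential is $d=\sum_{e\notin s}(-1)^{t(s,e)}d_e$, where $t(s,e)$ is the number of edges of $s$ preceding $e$ in a fixed ordering of the edges, and $d_e$ multiplies the two factors of the components of $[G:s]$ joined by $e$, or is the identity if both ends of $e$ lie in the same component. Then $$H_1(X_\Delta;\mathbb Z)\cong \mathbb Z^{c}\oplus \mathbb Z_2^{\,p_0(G_\Delta)-c}\oplus \mathbb Z_3^{\,v-1+\dim H_1(\hat X_3;\mathbb Z_3)-c},$$ and in particular $H_1(X_\Delta;\mathbb Z)$ has no element of order $9$. Moreover, for every ordering of the edges, $$H^{1,2v-3}_{\mathcal A_3}(G)\cong \mathbb Z_2^{\,p_0(G_\Delta)-c}\oplus \mathbb Z_3^{\,v-1+\dim H_1(\hat X_3;\mathbb Z_3)-c}\oplus \mathbb Z^{\,c+t_2+2t_3-E-d_2/2}.$$ All exponents are non-negative integers. -/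

import Mathlib

open scoped TensorProduct
open Polynomial

noncomputable section

universe u v

/-! ### Two-dimensional cell complexes and their cellular homology -/

/-- A two-dimensional cell complex in combinatorial form. `Dart` is the set of oriented 1-cells:
every 1-cell occurs as two darts exchanged by `rev`. A 2-cell `c` is attached along the closed
edge path `att c`. -/
structure CellComplex where
  Vertex : Type u
  Dart : Type u
  Cell : Type u
  src : Dart → Vertex
  rev : Dart → Dart
  rev_rev : ∀ d, rev (rev d) = d
  rev_ne : ∀ d, rev d ≠ d
  att : Cell → List Dart
  att_closed : ∀ c, Cycle.Chain (fun d e => src (rev d) = src e) (att c : Cycle Dart)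

namespace CellComplex

variable (K : CellComplex.{u}) (R : Type v) [CommRing R]

/-- The relations `(reversed dart) = -(dart)` between oriented 1-cells. -/
def reversal : Submodule R (K.Dart →₀ R) :=
  Submodule.span R
    (Set.range fun d : K.Dart => Finsupp.single d (1 : R) + Finsupp.single (K.rev d) 1)

/-- Cellular 0-chains. -/
abbrev C₀ : Type (max u v) := K.Vertex →₀ R

/-- Cellular 1-chains: the free module on the 1-cells, a reversed 1-cell being its negative. -/
abbrev C₁ : Type (max u v) := (K.Dart →₀ R) ⧸ K.reversal R

/-- Cellular 2-chains. -/
abbrev C₂ : Type (max u v) := K.Cell →₀ R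

/-- The 1-chain of an oriented 1-cell. -/
def chain (d : K.Dart) : K.C₁ R := (K.reversal R).mkQ (Finsupp.single d 1)

/-- The boundary of a 1-cell is its terminal vertex minus its initial vertex. -/
def boundary₁ : K.C₁ R →ₗ[R] K.C₀ R :=
  (K.reversal R).liftQ
    (Finsupp.linearCombination R fun d : K.Dart =>
      Finsupp.single (K.src (K.rev d)) (1 : R) - Finsupp.single (K.src d) 1)
    (by
      rw [reversal, Submodule.span_le]
      rintro _ ⟨d, rfl⟩
      simp [K.rev_rev])

/-- The boundary of a 2-cell is the sum of the darts of its attaching path. -/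
def boundary₂ : K.C₂ R →ₗ[R] K.C₁ R :=
  Finsupp.linearCombination R fun c : K.Cell => ((K.att c).map (K.chain R)).sum

/-- `H₁(K; R)`: the 1-cycles modulo the boundaries of 2-chains. -/
abbrev H₁ : Type (max u v) :=
  LinearMap.ker (K.boundary₁ R) ⧸
    (LinearMap.range (K.boundary₂ R)).comap (LinearMap.ker (K.boundary₁ R)).subtype

end CellComplex

namespace SimpleGraph

variable {V : Type u} (G : SimpleGraph V)

/-! ### Triangles and the complexes built from them -/

/-- The 3-cycles of `G`, as sets of vertices. -/
abbrev Triangle : Type u := {t : Finset V // G.IsNClique 3 t}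

variable {G} in
theorem Triangle.exists_corners (t : G.Triangle) :
    ∃ p : V × V × V, G.Adj p.1 p.2.1 ∧ G.Adj p.2.1 p.2.2 ∧ G.Adj p.2.2 p.1 ∧
      ∀ x, x ∈ t.1 ↔ x = p.1 ∨ x = p.2.1 ∨ x = p.2.2 := by
  classical
  obtain ⟨a, b, c, hab, hac, hbc, h⟩ := SimpleGraph.is3Clique_iff.1 t.2
  exact ⟨(a, b, c), hab, hbc, hac.symm, fun x => by simp [h]⟩

variable {G} in
/-- A listing of the three vertices of a triangle; it fixes a direction around the triangle. -/
def Triangle.corners (t : G.Triangle) : V × V × V := t.exists_corners.choose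

variable {G} in
theorem Triangle.corners_spec (t : G.Triangle) :
    G.Adj t.corners.1 t.corners.2.1 ∧ G.Adj t.corners.2.1 t.corners.2.2 ∧
      G.Adj t.corners.2.2 t.corners.1 ∧
      ∀ x, x ∈ t.1 ↔ x = t.corners.1 ∨ x = t.corners.2.1 ∨ x = t.corners.2.2 :=
  t.exists_corners.choose_spec

variable {G} in
/-- First edge of the oriented triangle. -/
def Triangle.e₁ (t : G.Triangle) : G.Dart := ⟨(t.corners.1, t.corners.2.1), t.corners_spec.1⟩

variable {G} in
/-- Second edge of the oriented triangle. -/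
def Triangle.e₂ (t : G.Triangle) : G.Dart :=
  ⟨(t.corners.2.1, t.corners.2.2), t.corners_spec.2.1⟩

variable {G} in
/-- Third edge of the oriented triangle. -/
def Triangle.e₃ (t : G.Triangle) : G.Dart := ⟨(t.corners.2.2, t.corners.1), t.corners_spec.2.2.1⟩

/-- The complex obtained from `G` by attaching a 2-cell along every 3-cycle. -/
def hatX₃ : CellComplex.{u} where
  Vertex := V
  Dart := G.Dart
  Cell := G.Triangle
  src d := d.fst
  rev d := d.symm
  rev_rev d := d.symm_symm
  rev_ne d := d.symm_ne
  att t := [t.e₁, t.e₂, t.e₃]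
  att_closed t := by simp [Triangle.e₁, Triangle.e₂, Triangle.e₃]

/-- The complex obtained from `G` by identifying all vertices and then attaching, for every
3-cycle with coherently oriented edges `e₁, e₂, e₃`, two 2-cells: one along
`2 e₃ - e₂ - e₁` and one along `2 e₁ - e₃ - e₂`. -/
def XΔ : CellComplex.{u} where
  Vertex := PUnit
  Dart := G.Dart
  Cell := G.Triangle × Bool
  src _ := PUnit.unit
  rev d := d.symm
  rev_rev d := d.symm_symm
  rev_ne d := d.symm_ne
  att c := match c with
    | (t, true) => [t.e₃, t.e₂.symm, t.e₃, t.e₁.symm]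
    | (t, false) => [t.e₁, t.e₃.symm, t.e₁, t.e₂.symm]
  att_closed c := by
    rcases c with ⟨t, _ | _⟩ <;> simp

/-- Every 4-cycle `a b c d` of `G` has a diagonal. -/
def IsSquareCordial : Prop :=
  ∀ a b c d : V, G.Adj a b → G.Adj b c → G.Adj c d → G.Adj d a → a ≠ c → b ≠ d →
    G.Adj a c ∨ G.Adj b d

/-- The graph of triangles: its vertices are the 3-cycles of `G`, two distinct ones being joined
when they share an edge. -/
def triangleGraph : SimpleGraph G.Triangle where
  Adj s t := s ≠ t ∧ ∃ e ∈ G.edgeSet, ∀ x ∈ e, x ∈ s.1 ∧ x ∈ t.1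
  symm := ⟨fun _ _ h => ⟨h.1.symm, h.2.imp fun _ he => ⟨he.1, fun x hx => (he.2 x hx).symm⟩⟩⟩
  loopless := ⟨fun _ h => h.1 rfl⟩

/-- The defining relations of a component `C` of the graph of triangles: consecutive edges of a
coherently oriented triangle of `C` are identified. -/
def CoherenceRel (C : G.triangleGraph.ConnectedComponent) (d e : G.Dart) : Prop :=
  ∃ t : G.Triangle, G.triangleGraph.connectedComponentMk t = C ∧
    d.snd = e.fst ∧ d.fst ≠ e.snd ∧ d.fst ∈ t.1 ∧ d.snd ∈ t.1 ∧ e.snd ∈ t.1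

/-- A component is coherent if its relations never identify an edge with its reverse. -/
def IsCoherent (C : G.triangleGraph.ConnectedComponent) : Prop :=
  ∀ d : G.Dart, ¬ Relation.EqvGen (G.CoherenceRel C) d d.symm

/-- The number of components of the graph of triangles. -/
def numTriangleComponents : ℕ := Nat.card G.triangleGraph.ConnectedComponent

/-- The number of coherent components of the graph of triangles. -/
def numCoherentComponents : ℕ :=
  Nat.card {C : G.triangleGraph.ConnectedComponent // G.IsCoherent C}

/-- The number `t_k` of unordered triples of distinct vertices spanning exactly `k` edges. -/
def numTriples (k : ℕ) : ℕ :=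
  Set.ncard {T : Finset V | T.card = 3 ∧ Set.ncard {e ∈ G.edgeSet | ∀ x ∈ e, x ∈ T} = k}

/-- The number `d_2` of ordered pairs of vertices at distance two. -/
def numPairsAtDistTwo : ℕ := Set.ncard {p : V × V | G.dist p.1 p.2 = 2}

/-! ### Chromatic graph cohomology over `ℤ[x]/(x^m)` -/

/-- The algebra `𝒜_m = ℤ[x]/(x^m)`. -/
abbrev TruncAlg (m : ℕ) : Type := AdjoinRoot (X ^ m : ℤ[X])

/-- The generator `x` of `𝒜_m`, of degree one. -/
def TruncAlg.x (m : ℕ) : TruncAlg m := AdjoinRoot.root (X ^ m : ℤ[X])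

/-- The graph `[G : s]` with all vertices of `G` and the edges in `s`. -/
def stateGraph (s : Finset G.edgeSet) : SimpleGraph V :=
  SimpleGraph.fromEdgeSet (Subtype.val '' (s : Set G.edgeSet))

/-- The components of `[G : s]`. -/
abbrev StateComp (s : Finset G.edgeSet) : Type u := (G.stateGraph s).ConnectedComponent

variable {G} in
theorem stateGraph_mono {s t : Finset G.edgeSet} (h : s ⊆ t) :
    G.stateGraph s ≤ G.stateGraph t :=
  SimpleGraph.fromEdgeSet_mono (Set.image_mono (by exact_mod_cast h))

variable {G} in
/-- The component of `[G : t]` that contains a given component of `[G : s]`, when `s ⊆ t`. -/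
def compMap {s t : Finset G.edgeSet} (h : s ⊆ t) : G.StateComp s → G.StateComp t :=
  SimpleGraph.ConnectedComponent.map (SimpleGraph.Hom.ofLE (stateGraph_mono h))

/-- The group `𝒜_m ^ ⊗ k(s)`: one tensor factor for every component of `[G : s]`. -/
abbrev StateModule (m : ℕ) (s : Finset G.edgeSet) : Type u :=
  ⨂[ℤ] _ : G.StateComp s, TruncAlg m

instance [Finite V] (s : Finset G.edgeSet) : Finite (G.StateComp s) :=
  inferInstanceAs (Finite (Quot _))

instance [Finite V] (s : Finset G.edgeSet) : Fintype (G.StateComp s) := Fintype.ofFinite _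

variable {G} in
open Classical in
theorem prod_fiber_update [Finite V] (m : ℕ) {s t : Finset G.edgeSet} (h : s ⊆ t)
    [DecidableEq (G.StateComp s)] (a : G.StateComp s → TruncAlg m) (i : G.StateComp s)
    (x : TruncAlg m) :
    (fun c' => ∏ c with compMap h c = c', Function.update a i x c) =
      Function.update (fun c' => ∏ c with compMap h c = c', a c) (compMap h i)
        (x * ∏ c ∈ (Finset.univ.filter fun c => compMap h c = compMap h i).erase i, a c) := by
  funext c'
  rcases eq_or_ne c' (compMap h i) with rfl | hne
  · rw [Function.update_self, ← Finset.mul_prod_erase _ _ (a := i) (by simp),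
      Function.update_self]
    congr 1
    exact Finset.prod_congr rfl fun c hc =>
      Function.update_of_ne (Finset.ne_of_mem_erase hc) _ _
  · rw [Function.update_of_ne hne]
    refine Finset.prod_congr rfl fun c hc => Function.update_of_ne ?_ _ _
    rintro rfl
    exact hne (Finset.mem_filter.1 hc).2.symm

variable {G} in
open Classical in
/-- The map `𝒜_m ^ ⊗ k(s) → 𝒜_m ^ ⊗ k(t)` for `s ⊆ t` that multiplies the factors of all
components that become connected. If `t` is `s` with one edge added, it multiplies
the two factors of the components joined by that edge, and it is the identity if the edge
has both ends in the same component. -/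
def mergeMap [Finite V] (m : ℕ) {s t : Finset G.edgeSet} (h : s ⊆ t) :
    G.StateModule m s →ₗ[ℤ] G.StateModule m t :=
  PiTensorProduct.lift
    { toFun := fun a => ⨂ₜ[ℤ] c', ∏ c with compMap h c = c', a c
      map_update_add' := by
        intro _ a i x y
        simp only [prod_fiber_update, add_mul, MultilinearMap.map_update_add]
      map_update_smul' := by
        intro _ a i r x
        simp only [prod_fiber_update, smul_mul_assoc, MultilinearMap.map_update_smul] }

/-- The cochains of all degrees: the sum of the groups `𝒜_m ^ ⊗ k(s)` over all `s ⊆ E(G)`. -/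
abbrev Cochain (m : ℕ) : Type u := ∀ s : Finset G.edgeSet, G.StateModule m s

/-- The part of `𝒜_m ^ ⊗ k(s)` of degree `j`, where `x` has degree one: it is spanned by the tensor
products of monomials `x ^ w c` with exponents of sum `j`. -/
def stateDegree [Finite V] (m : ℕ) (s : Finset G.edgeSet) (j : ℤ) :
    Submodule ℤ (G.StateModule m s) :=
  Submodule.span ℤ
    {z | ∃ w : G.StateComp s → ℕ, ((∑ c, w c : ℕ) : ℤ) = j ∧
      z = ⨂ₜ[ℤ] c, TruncAlg.x m ^ w c}

/-- The cochain group `C^{i,j}`: the cochains supported on the states with `i` edges,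
with all values of degree `j`. -/
def cochainDegree [Finite V] (m i : ℕ) (j : ℤ) : Submodule ℤ (G.Cochain m) where
  carrier := {f | ∀ s, f s ∈ G.stateDegree m s j ∧ (s.card ≠ i → f s = 0)}
  add_mem' hf hg s := ⟨add_mem (hf s).1 (hg s).1, fun h => by simp [(hf s).2 h, (hg s).2 h]⟩
  zero_mem' s := ⟨zero_mem _, fun _ => rfl⟩
  smul_mem' r _ hf s := ⟨Submodule.smul_mem _ r (hf s).1, fun h => by simp [(hf s).2 h]⟩

variable (num : G.edgeSet ≃ Fin (Nat.card G.edgeSet))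

open Classical in
/-- The coboundary `d = ∑ (-1)^{t(s,e)} d_e` over the edges `e ∉ s`, where `t(s,e)` is the number
of edges of `s` that precede `e` in the numbering `num` of the edges; its component at `t` collects
the terms with `s = t - e`, `e ∈ t`. -/
def coboundary [Finite V] (m : ℕ) : G.Cochain m →ₗ[ℤ] G.Cochain m :=
  LinearMap.pi fun t =>
    ∑ e ∈ t, (-1 : ℤ) ^ ((t.erase e).filter fun f => num f < num e).card •
      (mergeMap m (Finset.erase_subset e t) ∘ₗ LinearMap.proj (t.erase e))

/-- The cocycles in `C^{i,j}`. -/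
def cocycles [Finite V] (m i : ℕ) (j : ℤ) : Submodule ℤ (G.Cochain m) :=
  G.cochainDegree m i j ⊓ LinearMap.ker (G.coboundary num m)

/-- The coboundaries of the elements of `C^{i-1,j}` (there are none if `i = 0`). -/
def coboundaries [Finite V] (m i : ℕ) (j : ℤ) : Submodule ℤ (G.Cochain m) :=
  ⨆ (k : ℕ) (_ : k + 1 = i), (G.cochainDegree m k j).map (G.coboundary num m)

/-- The chromatic graph cohomology `H^{i,j}` of `G` over `𝒜_m`. -/
abbrev chromaticCohomology [Finite V] (m i : ℕ) (j : ℤ) : Type u :=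
  G.cocycles num m i j ⧸ (G.coboundaries num m i j).comap (G.cocycles num m i j).subtype

end SimpleGraph

end

noncomputable section

universe u v

section Duality

theorem exists_dotProduct_basis_eq {n ι : Type*} [Fintype n] (b : Module.Basis ι ℤ (n → ℤ))
    (c : ι → ℤ) : ∃ z : n → ℤ, ∀ i, z ⬝ᵥ b i = c i := by
  classical
  refine ⟨fun j => b.constr ℤ c (Pi.single j 1), fun i => ?_⟩
  rw [← b.constr_basis ℤ c i]
  conv_rhs => rw [LinearMap.pi_apply_eq_sum_univ (b.constr ℤ c) (b i)]
  simp only [dotProduct, smul_eq_mul, mul_comm]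
  refine Finset.sum_congr rfl fun x _ => ?_
  congr 2
  ext y
  simp [Pi.single_apply, eq_comm]

theorem eq_zero_of_dotProduct_basis {n ι : Type*} [Fintype n] (b : Module.Basis ι ℤ (n → ℤ))
    {y : n → ℤ} (h : ∀ i, y ⬝ᵥ b i = 0) : y = 0 := by
  classical
  have h0 : dotProductBilin ℤ ℤ y = (0 : (n → ℤ) →ₗ[ℤ] ℤ) := b.ext fun i => by simpa using h i
  ext j
  simpa using LinearMap.congr_fun h0 (Pi.single j 1)

theorem repr_sum_smul {R E ι κ : Type*} [CommRing R] [AddCommGroup E] [Module R E] [Fintype κ]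
    [DecidableEq ι] (b : Module.Basis ι R E) (f : κ → ι) (t : κ → R) (j : ι) :
    b.repr (∑ i, t i • b (f i)) j = ∑ i, if f i = j then t i else 0 := by
  simp only [map_sum, map_smul, Module.Basis.repr_self, Finsupp.coe_finsetSum, Finset.sum_apply,
    Finsupp.smul_apply, Finsupp.single_apply, smul_eq_mul, mul_ite, mul_one, mul_zero]

/-- The finite part and the free rank of a finitely generated abelian group are determined by
the group. -/
theorem finite_and_free_part_unique {S T : Type*} [AddCommGroup S] [AddCommGroup T] [Finite S]
    [Finite T] {k l : ℕ} (e : S × (Fin k → ℤ) ≃+ (Fin l → ℤ) × T) :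
    Nonempty (S ≃+ T) ∧ k = l := by
  have h1 (s : S) : (e (s, 0)).1 = 0 := by
    have h := (congrArg (fun z => (e z).1) (show (Nat.card S) • ((s, 0) : S × (Fin k → ℤ)) = 0 by
      simp))
    simp only [map_nsmul, Prod.smul_fst, map_zero, Prod.fst_zero] at h
    exact (smul_eq_zero.1 h).resolve_left Nat.card_pos.ne'
  have h2 (t : T) : (e.symm (0, t)).2 = 0 := by
    have h := (congrArg (fun z => (e.symm z).2)
      (show (Nat.card T) • ((0, t) : (Fin l → ℤ) × T) = 0 by simp))
    simp only [map_nsmul, Prod.smul_snd, map_zero, Prod.snd_zero] at h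
    exact (smul_eq_zero.1 h).resolve_left Nat.card_pos.ne'
  have h1' (s : S) : (0, (e (s, 0)).2) = e (s, 0) := Prod.ext (h1 s).symm rfl
  have h2' (t : T) : ((e.symm (0, t)).1, 0) = e.symm (0, t) := Prod.ext rfl (h2 t).symm
  refine ⟨⟨{ toFun := fun s => (e (s, 0)).2
             invFun := fun t => (e.symm (0, t)).1
             left_inv := fun s => by simp [h1']
             right_inv := fun t => by simp [h2']
             map_add' := fun x y => by
              rw [← Prod.snd_add, ← map_add]; simp }⟩, ?_⟩
  let f : (Fin k → ℤ) ≃+ (Fin l → ℤ) :=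
    { toFun := fun x => (e (0, x)).1
      invFun := fun y => (e.symm (y, 0)).2
      left_inv := fun x => by
        have : ((e (0, x)).1, (0 : T)) = e (0, x) - (0, (e (0, x)).2) := by ext <;> simp
        simp [this, h2]
      right_inv := fun y => by
        have : ((0 : S), (e.symm (y, 0)).2) = e.symm (y, 0) - ((e.symm (y, 0)).1, 0) := by
          ext <;> simp
        simp [this, h1]
      map_add' := fun x y => by
        rw [← Prod.fst_add, ← map_add]; simp }
  simpa using f.toIntLinearEquiv.finrank_eq

/-- The cokernels of an integral matrix and of its transpose have the same torsion. -/
theorem coker_transpose {m n : Type*} [Fintype m] [Fintype n] (M : Matrix m n ℤ)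
    {T : Type*} [AddCommGroup T] [Finite T] {c : ℕ}
    (e : ((n → ℤ) ⧸ Submodule.span ℤ (Set.range M)) ≃+ (Fin c → ℤ) × T) :
    ∃ r : ℕ, r + Fintype.card n = Fintype.card m + c ∧
      Nonempty (((m → ℤ) ⧸ Submodule.span ℤ (Set.range M.transpose)) ≃+ T × (Fin r → ℤ)) := by
  classical
  have hA : Submodule.span ℤ (Set.range M.transpose) = LinearMap.range M.mulVecLin :=
    (Matrix.range_mulVecLin M).symm
  have hB : Submodule.span ℤ (Set.range M) = LinearMap.range M.transpose.mulVecLin := by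
    rw [Matrix.range_mulVecLin]; rfl
  obtain ⟨k, snf⟩ := Submodule.smithNormalForm (Pi.basisFun ℤ m) (LinearMap.range M.mulVecLin)
  obtain ⟨bM, bN, f, a, hsnf⟩ := snf
  have ha (i) : a i ≠ 0 := fun h => bN.ne_zero i (Subtype.ext (by rw [hsnf, h, zero_smul]; rfl))
  have hp (i) : ∃ p, M.mulVecLin p = bN i := (bN i).2
  choose p hp using hp
  obtain ⟨l, q⟩ := Submodule.basisOfPid (Pi.basisFun ℤ n) (LinearMap.ker M.mulVecLin)
  have hq (j) : M.mulVecLin (q j) = 0 := (q j).2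
  have hli : LinearIndependent ℤ (Sum.elim p fun j => (q j : n → ℤ)) := by
    rw [Fintype.linearIndependent_iff]
    intro g hg
    have h0 : ∑ i, g (.inl i) • p i + ∑ j, g (.inr j) • (q j : n → ℤ) = 0 := by
      simpa [Fintype.sum_sum_type] using hg
    have h1 : ∑ i, g (.inl i) • (bN i) = 0 := by
      apply Subtype.ext
      have := congrArg M.mulVecLin h0
      rw [map_add, map_sum, map_sum] at this
      simp only [map_smul, hp, hq, smul_zero, Finset.sum_const_zero, add_zero, map_zero] at this
      simpa using this
    have h2 := Fintype.linearIndependent_iff.1 bN.linearIndependent _ h1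
    simp only [h2, zero_smul, Finset.sum_const_zero, zero_add] at h0
    have h3 := Fintype.linearIndependent_iff.1 q.linearIndependent (fun j => g (.inr j))
      (Subtype.ext (by simpa using h0))
    rintro (i | j)
    exacts [h2 i, h3 j]
  have hsp : ⊤ ≤ Submodule.span ℤ (Set.range (Sum.elim p fun j => (q j : n → ℤ))) := by
    intro x _
    have hx := bN.sum_repr ⟨M.mulVecLin x, ⟨x, rfl⟩⟩
    set t := bN.repr ⟨M.mulVecLin x, ⟨x, rfl⟩⟩
    have hk : x - ∑ i, t i • p i ∈ LinearMap.ker M.mulVecLin := by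
      have := congrArg Subtype.val hx
      simp only [AddSubmonoidClass.coe_finsetSum, Submodule.coe_smul] at this
      rw [LinearMap.mem_ker, map_sub, map_sum]
      simp only [map_smul, hp, this, sub_self]
    have h2 := congrArg Subtype.val (q.sum_repr ⟨_, hk⟩)
    simp only [AddSubmonoidClass.coe_finsetSum, Submodule.coe_smul] at h2
    rw [← sub_add_cancel x (∑ i, t i • p i), ← h2]
    refine add_mem (sum_mem fun j _ => ?_) (sum_mem fun i _ => ?_)
    · exact Submodule.smul_mem _ _ (Submodule.subset_span ⟨.inr j, rfl⟩)
    · exact Submodule.smul_mem _ _ (Submodule.subset_span ⟨.inl i, rfl⟩)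
  let bP : Module.Basis (Fin k ⊕ Fin l) ℤ (n → ℤ) := Module.Basis.mk hli hsp
  have hcard : Fintype.card n = k + l := by
    have h1 := Module.finrank_eq_card_basis bP
    simpa using h1
  have hcardm : Fintype.card {j // j ∉ Set.range f} + k = Fintype.card m := by
    have h1 : Fintype.card {j // j ∈ Set.range f} = k :=
      (Fintype.card_congr (Equiv.ofInjective f f.injective)).symm.trans (Fintype.card_fin k)
    have h2 := Fintype.card_subtype_compl (fun j => j ∈ Set.range f)
    have h3 := Fintype.card_subtype_le (fun j => j ∈ Set.range f)
    omega
  have (i : Fin k) : NeZero (a i).natAbs := ⟨Int.natAbs_ne_zero.2 (ha i)⟩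
  have hz (i : Fin k) (x : ℤ) : (x : ZMod (a i).natAbs) = 0 ↔ a i ∣ x := by
    rw [ZMod.intCast_zmod_eq_zero_iff_dvd, Int.natAbs_dvd]
  -- the cokernel of the matrix
  let πA : (m → ℤ) →+ (∀ i : Fin k, ZMod (a i).natAbs) × ({j // j ∉ Set.range f} → ℤ) :=
    { toFun := fun x => (fun i => (bM.repr x (f i) : ZMod _), fun j => bM.repr x j)
      map_zero' := Prod.ext (funext fun i => by simp) (funext fun j => by simp)
      map_add' := fun x y => Prod.ext (funext fun i => by simp) (funext fun j => by simp) }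
  have hπA : Function.Surjective πA := by
    rintro ⟨s, z⟩
    choose s' hs' using fun i => ZMod.intCast_surjective (s i)
    refine ⟨∑ i, s' i • bM (f i) + ∑ j, z j • bM j, Prod.ext (funext fun i => ?_)
      (funext fun j => ?_)⟩
    · have hj (j : {j // j ∉ Set.range f}) : (j : m) ≠ f i := fun h => j.2 ⟨i, h.symm⟩
      change Int.cast (bM.repr _ (f i)) = _
      rw [map_add, Finsupp.add_apply, repr_sum_smul, repr_sum_smul]
      simp [hs', hj]
    · have hj (i : Fin k) : f i ≠ j := fun h => j.2 ⟨i, h⟩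
      have hj' (i : {j // j ∉ Set.range f}) : (i : m) = j ↔ i = j := Subtype.ext_iff.symm
      change bM.repr _ _ = _
      rw [map_add, Finsupp.add_apply, repr_sum_smul, repr_sum_smul]
      simp [hj, hj']
  have hkA : (LinearMap.range M.mulVecLin).toAddSubgroup = πA.ker := by
    ext x
    simp only [Submodule.mem_toAddSubgroup, AddMonoidHom.mem_ker]
    constructor
    · intro hx
      have h := congrArg Subtype.val (bN.sum_repr ⟨x, hx⟩)
      simp only [AddSubmonoidClass.coe_finsetSum, Submodule.coe_smul, hsnf, smul_smul] at h
      set t := bN.repr ⟨x, hx⟩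
      rw [← h]
      refine Prod.ext (funext fun i => ?_) (funext fun j => ?_)
      · change Int.cast (bM.repr _ (f i)) = 0
        rw [hz, repr_sum_smul]
        simp
      · have hj (i : Fin k) : f i ≠ j := fun h => j.2 ⟨i, h⟩
        change bM.repr _ _ = 0
        rw [repr_sum_smul]
        simp [hj]
    · intro hx
      have h1 (i) : a i ∣ bM.repr x (f i) := (hz i _).1 (congrFun (congrArg Prod.fst hx) i)
      have h2 (j) (hj : j ∉ Set.range f) : bM.repr x j = 0 :=
        congrFun (congrArg Prod.snd hx) ⟨j, hj⟩
      rw [← bM.sum_repr x]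
      refine sum_mem fun j _ => ?_
      by_cases hj : j ∈ Set.range f
      · obtain ⟨i, rfl⟩ := hj
        obtain ⟨t, ht⟩ := h1 i
        rw [ht, mul_comm, mul_smul, ← hsnf]
        exact Submodule.smul_mem _ _ (bN i).2
      · rw [h2 j hj, zero_smul]
        exact zero_mem _
  -- the cokernel of the transpose
  let πB : (n → ℤ) →+ (∀ i : Fin k, ZMod (a i).natAbs) × (Fin l → ℤ) :=
    { toFun := fun y => (fun i => ((y ⬝ᵥ p i : ℤ) : ZMod _), fun j => y ⬝ᵥ (q j : n → ℤ))
      map_zero' := Prod.ext (funext fun i => by simp) (funext fun j => by simp)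
      map_add' := fun x y => Prod.ext (funext fun i => by simp [add_dotProduct])
        (funext fun j => by simp [add_dotProduct]) }
  have hπB : Function.Surjective πB := by
    rintro ⟨s, z⟩
    choose s' hs' using fun i => ZMod.intCast_surjective (s i)
    obtain ⟨y, hy⟩ := exists_dotProduct_basis_eq bP (Sum.elim s' z)
    refine ⟨y, Prod.ext (funext fun i => ?_) (funext fun j => ?_)⟩
    · have := hy (.inl i)
      simp only [bP, Module.Basis.mk_apply, Sum.elim_inl] at this
      simp [πB, this, hs']
    · have := hy (.inr j)
      simp only [bP, Module.Basis.mk_apply, Sum.elim_inr] at this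
      simp [πB, this]
  have hadj (z : m → ℤ) (x : n → ℤ) : (M.transpose.mulVecLin z) ⬝ᵥ x = z ⬝ᵥ M.mulVecLin x := by
    rw [Matrix.mulVecLin_apply, Matrix.mulVecLin_apply, Matrix.mulVec_transpose,
      Matrix.dotProduct_mulVec]
  have hkB : (LinearMap.range M.transpose.mulVecLin).toAddSubgroup = πB.ker := by
    ext y
    simp only [Submodule.mem_toAddSubgroup, AddMonoidHom.mem_ker]
    constructor
    · rintro ⟨z, rfl⟩
      refine Prod.ext (funext fun i => ?_) (funext fun j => ?_)
      · change Int.cast ((M.transpose.mulVecLin z) ⬝ᵥ p i) = 0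
        rw [hz, hadj, hp, hsnf, dotProduct_smul]
        exact Dvd.intro _ rfl
      · change (M.transpose.mulVecLin z) ⬝ᵥ (q j : n → ℤ) = 0
        rw [hadj, hq, dotProduct_zero]
    · intro hy
      have h1 (i) : a i ∣ y ⬝ᵥ p i := (hz i _).1 (congrFun (congrArg Prod.fst hy) i)
      have h2 (j) : y ⬝ᵥ (q j : n → ℤ) = 0 := congrFun (congrArg Prod.snd hy) j
      choose t ht using h1
      obtain ⟨z, hz'⟩ := exists_dotProduct_basis_eq bM
        (fun j => if h : j ∈ Set.range f then t h.choose else 0)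
      have hz'' (i) : z ⬝ᵥ bM (f i) = t i := by
        rw [hz', dif_pos ⟨i, rfl⟩]
        congr 1
        exact f.injective (Exists.choose_spec (p := fun y => f y = f i) ⟨i, rfl⟩)
      refine ⟨z, (sub_eq_zero.1 (eq_zero_of_dotProduct_basis bP fun i => ?_)).symm⟩
      rcases i with i | j
      · simp only [bP, Module.Basis.mk_apply, Sum.elim_inl]
        rw [sub_dotProduct, hadj, hp, hsnf, dotProduct_smul, hz'', ht]
        simp
      · simp only [bP, Module.Basis.mk_apply, Sum.elim_inr]
        rw [sub_dotProduct, hadj, hq, h2]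
        simp
  let eA : ((m → ℤ) ⧸ Submodule.span ℤ (Set.range M.transpose)) ≃+
      (∀ i : Fin k, ZMod (a i).natAbs) × ({j // j ∉ Set.range f} → ℤ) :=
    (QuotientAddGroup.quotientAddEquivOfEq (by rw [hA, hkA])).trans
      (QuotientAddGroup.quotientKerEquivOfSurjective πA hπA)
  let eB : ((n → ℤ) ⧸ Submodule.span ℤ (Set.range M)) ≃+
      (∀ i : Fin k, ZMod (a i).natAbs) × (Fin l → ℤ) :=
    (QuotientAddGroup.quotientAddEquivOfEq (by rw [hB, hkB])).trans
      (QuotientAddGroup.quotientKerEquivOfSurjective πB hπB)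
  obtain ⟨⟨g⟩, rfl⟩ := finite_and_free_part_unique (eB.symm.trans e)
  refine ⟨Fintype.card {j // j ∉ Set.range f}, by omega, ⟨eA.trans (g.prodCongr ?_)⟩⟩
  exact (LinearEquiv.funCongrLeft ℤ ℤ (Fintype.equivFin {j // j ∉ Set.range f}).symm).toAddEquiv

end Duality

section EdgeGroup

namespace CellComplex

variable (K : CellComplex.{u}) (R : Type v) [CommRing R]

theorem chain_rev (d : K.Dart) : K.chain R (K.rev d) = -K.chain R d := by
  rw [eq_neg_iff_add_eq_zero, add_comm, chain, chain, ← map_add, Submodule.mkQ_apply,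
    Submodule.Quotient.mk_eq_zero]
  exact Submodule.subset_span ⟨d, rfl⟩

/-- If the boundary of every 1-cell vanishes, then `H₁` is the cokernel of the boundary map. -/
def H₁EquivOfBoundaryEqZero (h : K.boundary₁ R = 0) :
    K.H₁ R ≃ₗ[R] K.C₁ R ⧸ LinearMap.range (K.boundary₂ R) :=
  Submodule.Quotient.equiv _ _
    ((LinearEquiv.ofEq _ _ (by rw [h, LinearMap.ker_zero])).trans Submodule.topEquiv) (by
      ext x
      simp only [Submodule.mem_map, Submodule.mem_comap]
      constructor
      · rintro ⟨y, hy, rfl⟩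
        exact hy
      · intro hx
        exact ⟨⟨x, by simp [h]⟩, hx, rfl⟩)

theorem boundary₂_single (c : K.Cell) :
    K.boundary₂ R (Finsupp.single c 1) = ((K.att c).map (K.chain R)).sum := by
  simp [boundary₂]

theorem boundary₁_chain (d : K.Dart) : K.boundary₁ R (K.chain R d) =
    Finsupp.single (K.src (K.rev d)) 1 - Finsupp.single (K.src d) 1 := by
  simp [boundary₁, chain]

variable {R} in
theorem C₁_hom_ext {A : Type*} [AddCommGroup A] [Module R A] {f g : K.C₁ R →ₗ[R] A}
    (h : ∀ d, f (K.chain R d) = g (K.chain R d)) : f = g :=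
  Submodule.linearMap_qext _ (Finsupp.lhom_ext' fun d => LinearMap.ext_ring (h d))

variable {R} in
/-- The linear map on 1-chains with given values on the oriented 1-cells. -/
def chainLift {A : Type*} [AddCommGroup A] [Module R A] (g : K.Dart → A)
    (hg : ∀ d, g (K.rev d) = -g d) : K.C₁ R →ₗ[R] A :=
  (K.reversal R).liftQ (Finsupp.linearCombination R g) (by
    rw [reversal, Submodule.span_le]
    rintro _ ⟨d, rfl⟩
    simp [hg])

variable {R} in
@[simp]
theorem chainLift_chain {A : Type*} [AddCommGroup A] [Module R A] (g : K.Dart → A)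
    (hg : ∀ d, g (K.rev d) = -g d) (d : K.Dart) :
    K.chainLift (R := R) g hg (K.chain R d) = g d := by
  simp [chainLift, chain]

end CellComplex

namespace SimpleGraph

variable {V : Type u} (G : SimpleGraph V)

theorem boundary₁_XΔ : G.XΔ.boundary₁ ℤ = 0 :=
  CellComplex.C₁_hom_ext _ fun d => by
    rw [CellComplex.boundary₁_chain]
    exact sub_self _

/-- The 1-chain of `X_Δ` of an oriented edge. -/
def edgeChain (d : G.Dart) : G.XΔ.C₁ ℤ := G.XΔ.chain ℤ d

variable {G} in
theorem edgeChain_symm (d : G.Dart) : G.edgeChain d.symm = -G.edgeChain d :=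
  G.XΔ.chain_rev ℤ d

variable {G} in
theorem boundary₂_XΔ_true (t : G.Triangle) : G.XΔ.boundary₂ ℤ (Finsupp.single (t, true) 1) =
    2 • G.edgeChain t.e₃ - (G.edgeChain t.e₁ + G.edgeChain t.e₂) := by
  refine (G.XΔ.boundary₂_single ℤ (t, true)).trans ?_
  change G.edgeChain t.e₃ + (G.edgeChain t.e₂.symm + (G.edgeChain t.e₃ +
    (G.edgeChain t.e₁.symm + 0))) = _
  rw [edgeChain_symm, edgeChain_symm]
  abel

variable {G} in
theorem boundary₂_XΔ_false (t : G.Triangle) : G.XΔ.boundary₂ ℤ (Finsupp.single (t, false) 1) =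
    2 • G.edgeChain t.e₁ - (G.edgeChain t.e₃ + G.edgeChain t.e₂) := by
  refine (G.XΔ.boundary₂_single ℤ (t, false)).trans ?_
  change G.edgeChain t.e₁ + (G.edgeChain t.e₃.symm + (G.edgeChain t.e₁ +
    (G.edgeChain t.e₂.symm + 0))) = _
  rw [edgeChain_symm, edgeChain_symm]
  abel

/-- The group generated by the oriented edges of `G` with the relations of the 2-cells
of `X_Δ`. -/
abbrev EdgeGroup : Type u := G.XΔ.C₁ ℤ ⧸ LinearMap.range (G.XΔ.boundary₂ ℤ)

/-- `H₁(X_Δ)` is the edge group, as all the edges are loops. -/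
def H₁EquivEdgeGroup : G.XΔ.H₁ ℤ ≃+ G.EdgeGroup :=
  (G.XΔ.H₁EquivOfBoundaryEqZero ℤ G.boundary₁_XΔ).toAddEquiv

open Classical in
/-- The class of the oriented edge from `a` to `b`, and zero if `a` and `b` are not adjacent. -/
def arc (a b : V) : G.EdgeGroup :=
  if h : G.Adj a b then
    (LinearMap.range (G.XΔ.boundary₂ ℤ)).mkQ (G.edgeChain ⟨(a, b), h⟩)
  else 0

variable {G}

theorem arc_of_adj {a b : V} (h : G.Adj a b) :
    G.arc a b = (LinearMap.range (G.XΔ.boundary₂ ℤ)).mkQ (G.edgeChain ⟨(a, b), h⟩) :=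
  dif_pos h

theorem arc_symm (a b : V) : G.arc b a = -G.arc a b := by
  by_cases h : G.Adj a b
  · rw [arc_of_adj h, arc_of_adj h.symm, ← map_neg, ← edgeChain_symm]
    rfl
  · rw [arc, arc, dif_neg h, dif_neg (fun h' => h h'.symm), neg_zero]

theorem arc_corners (t : G.Triangle) :
    2 • G.arc t.corners.2.2 t.corners.1 =
        G.arc t.corners.1 t.corners.2.1 + G.arc t.corners.2.1 t.corners.2.2 ∧
      2 • G.arc t.corners.1 t.corners.2.1 =
        G.arc t.corners.2.2 t.corners.1 + G.arc t.corners.2.1 t.corners.2.2 := by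
  have hs := t.corners_spec
  have h (b : Bool) : (LinearMap.range (G.XΔ.boundary₂ ℤ)).mkQ
      (G.XΔ.boundary₂ ℤ (Finsupp.single (t, b) 1)) = 0 :=
    (Submodule.Quotient.mk_eq_zero _).2 ⟨_, rfl⟩
  rw [arc_of_adj hs.1, arc_of_adj hs.2.1, arc_of_adj hs.2.2.1]
  constructor <;> rw [← sub_eq_zero, ← map_nsmul, ← map_add, ← map_sub]
  · exact (congrArg _ (boundary₂_XΔ_true t)).symm.trans (h true)
  · exact (congrArg _ (boundary₂_XΔ_false t)).symm.trans (h false)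

/-- The triangle with three given mutually adjacent vertices. -/
def triangleOf {a b c : V} [DecidableEq V] (hab : G.Adj a b) (hbc : G.Adj b c)
    (hca : G.Adj c a) : G.Triangle :=
  ⟨{a, b, c}, is3Clique_triple_iff.2 ⟨hab, hca.symm, hbc⟩⟩

/-- A statement about the corners of a triangle that is invariant under rotation and reflection
holds for every listing of the corners. -/
theorem corners_induction {P : V → V → V → Prop} (hrot : ∀ a b c, P a b c → P b c a)
    (hrefl : ∀ a b c, P a b c → P c b a) (t : G.Triangle)
    (h : P t.corners.1 t.corners.2.1 t.corners.2.2)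
    {a b c : V} (hab : a ≠ b) (hbc : b ≠ c) (hca : c ≠ a) (ha : a ∈ t.1) (hb : b ∈ t.1)
    (hc : c ∈ t.1) : P a b c := by
  have hs := t.corners_spec.2.2.2
  have h1 := hrot _ _ _ h
  have h2 := hrot _ _ _ h1
  have h3 := hrefl _ _ _ h
  have h4 := hrefl _ _ _ h1
  have h5 := hrefl _ _ _ h2
  have ha' := (hs a).1 ha
  have hb' := (hs b).1 hb
  have hc' := (hs c).1 hc
  clear hs hrot hrefl
  grind

theorem two_arc {a b c : V} (hab : G.Adj a b) (hbc : G.Adj b c) (hca : G.Adj c a) :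
    2 • G.arc c a = G.arc a b + G.arc b c := by
  classical
  suffices 2 • G.arc c a = G.arc a b + G.arc b c ∧ 2 • G.arc a b = G.arc c a + G.arc b c from
    this.1
  refine corners_induction (G := G) (P := fun a b c => 2 • G.arc c a = G.arc a b + G.arc b c ∧
    2 • G.arc a b = G.arc c a + G.arc b c) ?_ ?_ (triangleOf hab hbc hca) (arc_corners _)
    hab.ne hbc.ne hca.ne ?_ ?_ ?_
  · rintro a b c ⟨h1, h2⟩
    exact ⟨h2.trans (add_comm _ _), by linear_combination (norm := module) -h1 - h2⟩
  · rintro a b c ⟨h1, h2⟩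
    rw [arc_symm c a, arc_symm a b, arc_symm b c]
    exact ⟨by linear_combination (norm := module) -h1, by linear_combination (norm := module) h1 + h2⟩
  all_goals simp [triangleOf]

theorem three_arc {a b c : V} (hab : G.Adj a b) (hbc : G.Adj b c) (hca : G.Adj c a) :
    3 • G.arc a b = 3 • G.arc b c := by
  have h1 := two_arc hab hbc hca
  have h2 := two_arc hbc hca hab
  have h3 := two_arc hca hab hbc
  have e1 : 3 • G.arc a b = 2 • G.arc a b + G.arc a b := by abel
  have e2 : 3 • G.arc b c = 2 • G.arc b c + G.arc b c := by abel
  rw [e1, e2, h2, h3]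
  abel

variable {A : Type*} [AddCommGroup A]

theorem edgeGroup_hom_ext {f g : G.EdgeGroup →ₗ[ℤ] A}
    (h : ∀ a b, G.Adj a b → f (G.arc a b) = g (G.arc a b)) : f = g := by
  refine Submodule.linearMap_qext _ (CellComplex.C₁_hom_ext _ fun d => ?_)
  have := h d.fst d.snd d.adj
  rwa [arc_of_adj d.adj] at this

/-- The homomorphism on 1-chains of `X_Δ` with given values on the oriented edges. -/
def edgeChainLift (g : V → V → A) (hsymm : ∀ a b, G.Adj a b → g b a = -g a b) :
    G.XΔ.C₁ ℤ →ₗ[ℤ] A :=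
  G.XΔ.chainLift (R := ℤ) (fun d : G.Dart => g d.fst d.snd) fun d => hsymm _ _ d.adj

theorem edgeChainLift_edgeChain (g : V → V → A) (hsymm : ∀ a b, G.Adj a b → g b a = -g a b)
    (d : G.Dart) : edgeChainLift g hsymm (G.edgeChain d) = g d.fst d.snd :=
  G.XΔ.chainLift_chain (R := ℤ) (fun d : G.Dart => g d.fst d.snd) _ d

/-- The homomorphism from the edge group with given values on the oriented edges. -/
def edgeGroupLift (g : V → V → A) (hsymm : ∀ a b, G.Adj a b → g b a = -g a b)
    (hrel : ∀ a b c, G.Adj a b → G.Adj b c → G.Adj c a → 2 • g c a = g a b + g b c) :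
    G.EdgeGroup →ₗ[ℤ] A :=
  (LinearMap.range (G.XΔ.boundary₂ ℤ)).liftQ (edgeChainLift g hsymm) (by
    rw [LinearMap.range_le_ker_iff]
    refine Finsupp.lhom_ext' fun c => LinearMap.ext_ring ?_
    obtain ⟨t, b⟩ := c
    have hs := t.corners_spec
    have h1 := hrel _ _ _ hs.1 hs.2.1 hs.2.2.1
    have h2 := hrel _ _ _ hs.2.1 hs.2.2.1 hs.1
    cases b
    · refine (congrArg (edgeChainLift g hsymm) (boundary₂_XΔ_false t)).trans ?_
      simp only [map_sub, map_add, map_nsmul, edgeChainLift_edgeChain]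
      exact sub_eq_zero.2 (h2.trans (add_comm _ _))
    · refine (congrArg (edgeChainLift g hsymm) (boundary₂_XΔ_true t)).trans ?_
      simp only [map_sub, map_add, map_nsmul, edgeChainLift_edgeChain]
      exact sub_eq_zero.2 h1)

@[simp]
theorem edgeGroupLift_arc (g : V → V → A) (hsymm : ∀ a b, G.Adj a b → g b a = -g a b)
    (hrel : ∀ a b c, G.Adj a b → G.Adj b c → G.Adj c a → 2 • g c a = g a b + g b c)
    {a b : V} (h : G.Adj a b) : edgeGroupLift g hsymm hrel (G.arc a b) = g a b := by
  rw [arc_of_adj h]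
  exact edgeChainLift_edgeChain g hsymm ⟨(a, b), h⟩

end SimpleGraph

end EdgeGroup

namespace SimpleGraph

section Structure

variable {V : Type u} {G : SimpleGraph V} {C C' : G.triangleGraph.ConnectedComponent}
  {d e f : G.Dart}

/-- An oriented edge lies on a triangle of the component `C`. -/
def DartIn (C : G.triangleGraph.ConnectedComponent) (d : G.Dart) : Prop :=
  ∃ t : G.Triangle, G.triangleGraph.connectedComponentMk t = C ∧ d.fst ∈ t.1 ∧ d.snd ∈ t.1

theorem DartIn.symm (h : DartIn C d) : DartIn C d.symm :=
  h.imp fun _ ht => ⟨ht.1, ht.2.2, ht.2.1⟩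

theorem dartIn_symm : DartIn C d.symm ↔ DartIn C d :=
  ⟨fun h => by simpa using h.symm, DartIn.symm⟩

theorem connectedComponentMk_eq_of_mem {s t : G.Triangle} (hs : d.fst ∈ s.1 ∧ d.snd ∈ s.1)
    (ht : d.fst ∈ t.1 ∧ d.snd ∈ t.1) :
    G.triangleGraph.connectedComponentMk s = G.triangleGraph.connectedComponentMk t := by
  by_cases h : s = t
  · rw [h]
  · refine ConnectedComponent.sound (Adj.reachable ⟨h, s(d.fst, d.snd), d.adj, ?_⟩)
    simpa using ⟨⟨hs.1, ht.1⟩, hs.2, ht.2⟩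

theorem DartIn.unique (h : DartIn C d) (h' : DartIn C' d) : C = C' := by
  obtain ⟨s, rfl, hs⟩ := h
  obtain ⟨t, rfl, ht⟩ := h'
  exact connectedComponentMk_eq_of_mem hs ht

theorem exists_dartIn (htri : ∀ a b : V, G.Adj a b → ∃ c : V, G.Adj a c ∧ G.Adj b c)
    (d : G.Dart) : ∃ C, DartIn C d := by
  classical
  obtain ⟨c, hac, hbc⟩ := htri _ _ d.adj
  exact ⟨_, triangleOf d.adj hbc hac.symm, rfl, by simp [triangleOf], by simp [triangleOf]⟩

theorem adj_of_mem_triangle {t : G.Triangle} {a b : V} (ha : a ∈ t.1) (hb : b ∈ t.1)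
    (hab : a ≠ b) : G.Adj a b :=
  t.2.1 ha hb hab

theorem CoherenceRel.symm_symm (h : G.CoherenceRel C d e) :
    G.CoherenceRel C e.symm d.symm := by
  obtain ⟨t, ht, h1, h2, h3, h4, h5⟩ := h
  exact ⟨t, ht, h1.symm, h2.symm, h5, by simpa [← h1] using h4, h3⟩

theorem CoherenceRel.dartIn (h : G.CoherenceRel C d e) : DartIn C d ∧ DartIn C e := by
  obtain ⟨t, ht, h1, h2, h3, h4, h5⟩ := h
  exact ⟨⟨t, ht, h3, h4⟩, t, ht, h1 ▸ h4, h5⟩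

theorem eqvGen_symm_symm (h : Relation.EqvGen (G.CoherenceRel C) d e) :
    Relation.EqvGen (G.CoherenceRel C) d.symm e.symm := by
  induction h with
  | rel _ _ h => exact .symm _ _ (.rel _ _ h.symm_symm)
  | refl _ => exact .refl _
  | symm _ _ _ ih => exact .symm _ _ ih
  | trans _ _ _ _ _ ih1 ih2 => exact .trans _ _ _ ih1 ih2

theorem eqvGen_dartIn (h : Relation.EqvGen (G.CoherenceRel C) d e) :
    d = e ∨ DartIn C d ∧ DartIn C e := by
  induction h with
  | rel _ _ h => exact .inr h.dartIn
  | refl _ => exact .inl rfl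
  | symm _ _ _ ih => exact ih.imp Eq.symm And.symm
  | trans x y z _ _ ih1 ih2 =>
    rcases ih1 with rfl | h1
    · exact ih2
    · rcases ih2 with rfl | h2
      · exact .inr h1
      · exact .inr ⟨h1.1, h2.2⟩

theorem coherenceRel_of_adj {a b c : V} (hab : G.Adj a b) (hbc : G.Adj b c) (hca : G.Adj c a)
    (hC : DartIn C ⟨(a, b), hab⟩) : G.CoherenceRel C ⟨(a, b), hab⟩ ⟨(b, c), hbc⟩ := by
  classical
  obtain ⟨t, rfl, ht⟩ := hC
  refine ⟨triangleOf hab hbc hca, connectedComponentMk_eq_of_mem (d := ⟨(a, b), hab⟩) ?_ ht, rfl,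
    hca.ne', ?_, ?_, ?_⟩ <;> simp [triangleOf]

theorem eqvGen_or_of_mem {t : G.Triangle} (hd : d.fst ∈ t.1 ∧ d.snd ∈ t.1)
    (he : e.fst ∈ t.1 ∧ e.snd ∈ t.1) (ht : G.triangleGraph.connectedComponentMk t = C) :
    Relation.EqvGen (G.CoherenceRel C) d e ∨ Relation.EqvGen (G.CoherenceRel C) d e.symm := by
  have key {x y : G.Dart} (hx : x.fst ∈ t.1 ∧ x.snd ∈ t.1) (hy : y.fst ∈ t.1 ∧ y.snd ∈ t.1)
      (h : x.snd = y.fst) :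
      Relation.EqvGen (G.CoherenceRel C) x y ∨ Relation.EqvGen (G.CoherenceRel C) x y.symm := by
    by_cases h' : x.fst = y.snd
    · right
      have : y.symm = x := by ext; exacts [h'.symm, h.symm]
      rw [this]
      exact .refl _
    · exact .inl (.rel _ _ ⟨t, ht, h, h', hx.1, hx.2, hy.2⟩)
  classical
  obtain ⟨hd1, hd2⟩ := hd
  have hcard : t.1.card = 3 := t.2.2
  by_cases h1 : d.snd = e.fst
  · exact key ⟨hd1, hd2⟩ he h1
  by_cases h2 : d.snd = e.snd
  · have := key (y := e.symm) ⟨hd1, hd2⟩ he.symm h2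
    rw [Dart.symm_symm] at this
    exact this.symm
  have hde : d.fst = e.fst ∨ d.fst = e.snd := by
    by_contra! h
    have h4 : ({d.fst, d.snd, e.fst, e.snd} : Finset V).card = 4 := by
      have := d.adj.ne
      have := e.adj.ne
      rw [Finset.card_insert_of_notMem, Finset.card_insert_of_notMem, Finset.card_pair] <;>
        simp_all
    have h5 : ({d.fst, d.snd, e.fst, e.snd} : Finset V).card ≤ 3 := by
      rw [← hcard]
      refine Finset.card_le_card ?_
      intro x hx
      simp only [Finset.mem_insert, Finset.mem_singleton] at hx
      rcases hx with rfl | rfl | rfl | rfl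
      exacts [hd1, hd2, he.1, he.2]
    omega
  rcases hde with h | h
  · have := key (x := d.symm) (y := e) ⟨hd2, hd1⟩ he h
    exact (this.imp eqvGen_symm_symm eqvGen_symm_symm).symm.imp (by simp) (by simp)
  · have := key (x := d.symm) (y := e.symm) ⟨hd2, hd1⟩ he.symm h
    exact (this.imp eqvGen_symm_symm eqvGen_symm_symm).imp (by simp) (by simp)

theorem eqvGen_or (hd : DartIn C d) (he : DartIn C e) :
    Relation.EqvGen (G.CoherenceRel C) d e ∨ Relation.EqvGen (G.CoherenceRel C) d e.symm := by
  obtain ⟨s, hs, hd⟩ := hd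
  obtain ⟨t, ht, he⟩ := he
  have hst : G.triangleGraph.Reachable s t := ConnectedComponent.exact (hs.trans ht.symm)
  rw [reachable_iff_reflTransGen] at hst
  induction hst generalizing e with
  | refl => exact eqvGen_or_of_mem hd he hs
  | @tail b c hsb hbc ih =>
    obtain ⟨hne, x, hx, hxbc⟩ := hbc
    induction x with
    | h x y =>
      have hb := ih (e := ⟨(x, y), hx⟩)
        (((ConnectedComponent.sound (Adj.reachable
          (show G.triangleGraph.Adj b c from ⟨hne, s(x, y), hx, hxbc⟩)))).trans ht)
        ⟨(hxbc x (by simp)).1, (hxbc y (by simp)).1⟩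
      have hc := eqvGen_or_of_mem (d := ⟨(x, y), hx⟩) (e := e) (t := c)
        ⟨(hxbc x (by simp)).2, (hxbc y (by simp)).2⟩ he ht
      rcases hb with hb | hb
      · exact hc.imp (.trans _ _ _ hb) (.trans _ _ _ hb)
      · refine (hc.imp eqvGen_symm_symm eqvGen_symm_symm).symm.imp (fun h => ?_) (.trans _ _ _ hb)
        rw [Dart.symm_symm] at h
        exact .trans _ _ _ hb h

theorem exists_dartIn_component (C : G.triangleGraph.ConnectedComponent) :
    ∃ d : G.Dart, DartIn C d := by
  induction C using ConnectedComponent.ind with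
  | h t =>
    have hs := t.corners_spec.2.2.2
    exact ⟨t.e₁, t, rfl, (hs _).2 (.inl rfl), (hs _).2 (.inr (.inl rfl))⟩

/-- A chosen oriented edge of a component of the graph of triangles. -/
def refDart (C : G.triangleGraph.ConnectedComponent) : G.Dart :=
  (exists_dartIn_component C).choose

theorem dartIn_refDart (C : G.triangleGraph.ConnectedComponent) : DartIn C (refDart C) :=
  (exists_dartIn_component C).choose_spec

open Classical in
/-- The sign of an oriented edge relative to the chosen one of a component, and zero if the edge
does not belong to the component. -/
def compSign (C : G.triangleGraph.ConnectedComponent) (d : G.Dart) : ℤ :=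
  if DartIn C d then if Relation.EqvGen (G.CoherenceRel C) (refDart C) d then 1 else -1 else 0

theorem compSign_of_not (h : ¬DartIn C d) : compSign C d = 0 := if_neg h

theorem compSign_refDart (C : G.triangleGraph.ConnectedComponent) :
    compSign C (refDart C) = 1 := by
  rw [compSign, if_pos (dartIn_refDart C), if_pos (.refl _)]

theorem compSign_eq_or (h : DartIn C d) : compSign C d = 1 ∨ compSign C d = -1 := by
  rw [compSign, if_pos h]
  split_ifs <;> simp

theorem compSign_symm (hC : G.IsCoherent C) (d : G.Dart) :
    compSign C d.symm = -compSign C d := by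
  by_cases h : DartIn C d
  · rw [compSign, compSign, if_pos h, if_pos h.symm]
    have h1 := eqvGen_or (dartIn_refDart C) h
    have h2 : ¬(Relation.EqvGen (G.CoherenceRel C) (refDart C) d ∧
        Relation.EqvGen (G.CoherenceRel C) (refDart C) d.symm) := fun h' =>
      hC d (.trans _ _ _ (.symm _ _ h'.1) h'.2)
    split_ifs <;> first | rfl | (exfalso; tauto)
  · rw [compSign_of_not h, compSign_of_not (fun h' => h (dartIn_symm.1 h')), neg_zero]

theorem compSign_symm_zmod (C : G.triangleGraph.ConnectedComponent) (d : G.Dart) :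
    (compSign C d.symm : ZMod 2) = -(compSign C d : ZMod 2) := by
  by_cases h : DartIn C d
  · rcases compSign_eq_or h with h1 | h1 <;> rcases compSign_eq_or h.symm with h2 | h2 <;>
      rw [h1, h2] <;> decide
  · rw [compSign_of_not h, compSign_of_not (fun h' => h (dartIn_symm.1 h'))]
    simp

theorem compSign_eq {a b c : V} (hab : G.Adj a b) (hbc : G.Adj b c) (hca : G.Adj c a) :
    compSign C ⟨(a, b), hab⟩ = compSign C ⟨(b, c), hbc⟩ := by
  by_cases h : DartIn C ⟨(a, b), hab⟩
  · have hr := coherenceRel_of_adj hab hbc hca h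
    rw [compSign, compSign, if_pos h, if_pos hr.dartIn.2]
    congr 1
    exact propext ⟨fun h => .trans _ _ _ h (.rel _ _ hr),
      fun h => .trans _ _ _ h (.symm _ _ (.rel _ _ hr))⟩
  · have h' : ¬DartIn C ⟨(b, c), hbc⟩ := fun h' =>
      h (coherenceRel_of_adj hca hab hbc
        (coherenceRel_of_adj hbc hca hab h').dartIn.2).dartIn.2
    rw [compSign_of_not h, compSign_of_not h']

theorem three_arc_eq (h : Relation.EqvGen (G.CoherenceRel C) d e) :
    3 • G.arc d.fst d.snd = 3 • G.arc e.fst e.snd := by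
  induction h with
  | rel d e h =>
    obtain ⟨t, ht, h1, h2, h3, h4, h5⟩ := h
    rw [← h1]
    refine three_arc d.adj ?_ (adj_of_mem_triangle h5 h3 h2.symm)
    rw [h1]
    exact e.adj
  | refl _ => rfl
  | symm _ _ _ ih => exact ih.symm
  | trans _ _ _ _ _ ih1 ih2 => exact ih1.trans ih2

theorem three_arc_eq_compSign (h : DartIn C d) :
    3 • G.arc d.fst d.snd = compSign C d • 3 • G.arc (refDart C).fst (refDart C).snd := by
  rw [compSign, if_pos h]
  split_ifs with h1
  · rw [one_smul, three_arc_eq h1]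
  · have h2 := three_arc_eq ((eqvGen_or (dartIn_refDart C) h).resolve_left h1)
    rw [h2, Dart.symm_toProd, Prod.fst_swap, Prod.snd_swap, arc_symm d.fst d.snd, smul_neg, neg_smul, one_smul,
      neg_neg]

theorem six_arc_eq_zero (hC : ¬G.IsCoherent C) :
    6 • G.arc (refDart C).fst (refDart C).snd = 0 := by
  rw [IsCoherent] at hC
  push Not at hC
  obtain ⟨d, hd⟩ := hC
  have h1 := three_arc_eq hd
  rw [Dart.symm_toProd, Prod.fst_swap, Prod.snd_swap, arc_symm d.fst d.snd, smul_neg, eq_neg_iff_add_eq_zero,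
    ← add_smul] at h1
  have h2 : DartIn C d := ((eqvGen_dartIn hd).resolve_left d.symm_ne.symm).1
  have h3 := three_arc_eq_compSign h2
  have h4 : (2 * compSign C d) • 3 • G.arc (refDart C).fst (refDart C).snd = 0 := by
    rw [mul_smul, ← h3, ← h1]
    module
  rcases compSign_eq_or h2 with h5 | h5 <;> rw [h5] at h4
  · rw [← h4]
    module
  · rw [← neg_eq_zero, ← h4]
    module

variable (G)

/-- The target of the sign maps of all components. -/
abbrev SignGroup : Type u := ({C : G.triangleGraph.ConnectedComponent // G.IsCoherent C} → ℤ) ×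
  ({C : G.triangleGraph.ConnectedComponent // ¬G.IsCoherent C} → ZMod 2)

open Classical in
/-- The sign maps of all components, on ordered pairs of vertices. -/
def signVal (a b : V) : G.SignGroup :=
  if h : G.Adj a b then
    (fun C => compSign C.1 ⟨(a, b), h⟩, fun C => (compSign C.1 ⟨(a, b), h⟩ : ZMod 2))
  else 0

variable {G} in
theorem signVal_of_adj {a b : V} (h : G.Adj a b) : G.signVal a b =
    (fun C => compSign C.1 ⟨(a, b), h⟩, fun C => (compSign C.1 ⟨(a, b), h⟩ : ZMod 2)) :=
  dif_pos h

variable {G} in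
theorem signVal_eq {a b c : V} (hab : G.Adj a b) (hbc : G.Adj b c) (hca : G.Adj c a) :
    G.signVal a b = G.signVal b c := by
  rw [signVal_of_adj hab, signVal_of_adj hbc]
  simp only [compSign_eq hab hbc hca]

/-- The homomorphism that records the signs of the edges of every component. -/
def signHom : G.EdgeGroup →ₗ[ℤ] G.SignGroup :=
  edgeGroupLift G.signVal
    (fun a b h => by
      rw [signVal_of_adj h, signVal_of_adj h.symm]
      exact Prod.ext (funext fun C => compSign_symm C.2 ⟨(a, b), h⟩)
        (funext fun C => compSign_symm_zmod C.1 ⟨(a, b), h⟩))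
    (fun a b c hab hbc hca => by
      rw [signVal_eq hab hbc hca, signVal_eq hbc hca hab, two_nsmul])

theorem signHom_arc (d : G.Dart) : G.signHom (G.arc d.fst d.snd) =
    (fun C => compSign C.1 d, fun C => (compSign C.1 d : ZMod 2)) := by
  rw [signHom, edgeGroupLift_arc _ _ _ d.adj, signVal_of_adj d.adj]

instance [Finite V] : Finite G.Dart :=
  Finite.of_injective (fun d => d.toProd) Dart.toProd_injective

instance [Finite V] : Finite G.triangleGraph.ConnectedComponent :=
  inferInstanceAs (Finite (Quot _))

instance [Finite V] : Finite G.XΔ.Dart := inferInstanceAs (Finite G.Dart)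

theorem zmultiples_lift_aux (C : {C : G.triangleGraph.ConnectedComponent // ¬G.IsCoherent C}) :
    zmultiplesHom _ (3 • G.arc (refDart C.1).fst (refDart C.1).snd) ((2 : ℕ) : ℤ) = 0 := by
  rw [zmultiplesHom_apply, ← six_arc_eq_zero C.2]
  module

open Classical in
/-- A section of the homomorphism that records the signs. -/
def signSection [Finite V] : G.SignGroup →+ G.EdgeGroup :=
  letI := Fintype.ofFinite {C : G.triangleGraph.ConnectedComponent // G.IsCoherent C}
  letI := Fintype.ofFinite {C : G.triangleGraph.ConnectedComponent // ¬G.IsCoherent C}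
  AddMonoidHom.coprod
    (∑ C : {C : G.triangleGraph.ConnectedComponent // G.IsCoherent C},
      (zmultiplesHom _ (G.arc (refDart C.1).fst (refDart C.1).snd)).comp
        (Pi.evalAddMonoidHom _ C))
    (∑ C : {C : G.triangleGraph.ConnectedComponent // ¬G.IsCoherent C},
      (ZMod.lift 2 ⟨_, G.zmultiples_lift_aux C⟩).comp (Pi.evalAddMonoidHom _ C))

open Classical in
theorem signSection_inl [Finite V]
    (C : {C : G.triangleGraph.ConnectedComponent // G.IsCoherent C}) (n : ℤ) :
    G.signSection (Pi.single C n, 0) = n • G.arc (refDart C.1).fst (refDart C.1).snd := by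
  let := Fintype.ofFinite {C : G.triangleGraph.ConnectedComponent // G.IsCoherent C}
  rw [signSection, AddMonoidHom.coprod_apply, map_zero, add_zero, AddMonoidHom.finsetSum_apply,
    Finset.sum_eq_single C]
  · simp
  · intro C' _ h
    simp [h]
  · simp

open Classical in
theorem signSection_inr [Finite V]
    (C : {C : G.triangleGraph.ConnectedComponent // ¬G.IsCoherent C}) (n : ℤ) :
    G.signSection (0, Pi.single C (n : ZMod 2)) =
      n • 3 • G.arc (refDart C.1).fst (refDart C.1).snd := by
  let := Fintype.ofFinite {C : G.triangleGraph.ConnectedComponent // ¬G.IsCoherent C}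
  rw [signSection, AddMonoidHom.coprod_apply, map_zero, zero_add, AddMonoidHom.finsetSum_apply,
    Finset.sum_eq_single C]
  · simp only [AddMonoidHom.comp_apply, Pi.evalAddMonoidHom_apply, Pi.single_eq_same]
    rw [ZMod.lift_coe]
    rfl
  · intro C' _ h
    simp [h]
  · simp

theorem compSign_refDart_of_ne (h : C' ≠ C) : compSign C' (refDart C) = 0 :=
  compSign_of_not fun h' => h (h'.unique (dartIn_refDart C))

theorem signHom_signSection [Finite V] (x : G.SignGroup) :
    G.signHom (G.signSection x) = x := by
  classical
  suffices (G.signHom.toAddMonoidHom.comp G.signSection) = AddMonoidHom.id _ from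
    DFunLike.congr_fun this x
  have h1 (C : {C : G.triangleGraph.ConnectedComponent // G.IsCoherent C}) :
      G.signHom (G.arc (refDart C.1).fst (refDart C.1).snd) = (Pi.single C 1, 0) := by
    rw [signHom_arc]
    refine Prod.ext (funext fun C' => ?_) (funext fun C' => ?_)
    · by_cases h : C' = C
      · subst h
        simp [compSign_refDart]
      · simp only [Pi.single_eq_of_ne h]
        exact G.compSign_refDart_of_ne fun h' => h (Subtype.ext h')
    · simp [G.compSign_refDart_of_ne (C' := C'.1) (C := C.1) fun h' => C'.2 (h' ▸ C.2)]
  have h2 (C : {C : G.triangleGraph.ConnectedComponent // ¬G.IsCoherent C}) :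
      G.signHom (3 • G.arc (refDart C.1).fst (refDart C.1).snd) = (0, Pi.single C 1) := by
    rw [map_nsmul, signHom_arc]
    refine Prod.ext (funext fun C' => ?_) (funext fun C' => ?_)
    · simp [G.compSign_refDart_of_ne (C' := C'.1) (C := C.1) fun h' => C.2 (h' ▸ C'.2)]
    · by_cases h : C' = C
      · subst h
        simp [compSign_refDart]
        decide
      · simp [Pi.single_eq_of_ne h, G.compSign_refDart_of_ne (C' := C'.1) (C := C.1) fun h' =>
          h (Subtype.ext h')]
  suffices (G.signHom.toAddMonoidHom.comp G.signSection).comp (.inl _ _) = .inl _ _ ∧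
      (G.signHom.toAddMonoidHom.comp G.signSection).comp (.inr _ _) = .inr _ _ by
    rw [← AddMonoidHom.coprod_unique (G.signHom.toAddMonoidHom.comp G.signSection), this.1, this.2,
      AddMonoidHom.coprod_inl_inr]
  constructor
  · refine AddMonoidHom.functions_ext' _ _ _ fun C => AddMonoidHom.ext_int ?_
    have := G.signSection_inl C 1
    simp only [one_smul] at this
    simp only [AddMonoidHom.comp_apply, AddMonoidHom.inl_apply, AddMonoidHom.single_apply,
      LinearMap.toAddMonoidHom_coe]
    rw [this, h1]
  · refine AddMonoidHom.functions_ext' _ _ _ fun C => ?_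
    refine AddMonoidHom.ext fun z => ?_
    obtain ⟨n, rfl⟩ := ZMod.intCast_surjective z
    have := G.signSection_inr C n
    simp only [AddMonoidHom.comp_apply, AddMonoidHom.inr_apply, AddMonoidHom.single_apply,
      LinearMap.toAddMonoidHom_coe]
    rw [this, map_zsmul, h2]
    ext C'
    · simp
    · by_cases h : C' = C
      · subst h; simp
      · simp [Pi.single_eq_of_ne h]

theorem three_signSection_signHom [Finite V]
    (htri : ∀ a b : V, G.Adj a b → ∃ c : V, G.Adj a c ∧ G.Adj b c) (x : G.EdgeGroup) :
    3 • G.signSection (G.signHom x) = 3 • x := by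
  classical
  suffices (3 : ℤ) • (G.signSection.toIntLinearMap ∘ₗ G.signHom) = (3 : ℤ) • LinearMap.id by
    have := LinearMap.congr_fun this x
    simpa using this
  refine edgeGroup_hom_ext fun a b h => ?_
  simp only [LinearMap.smul_apply, LinearMap.comp_apply, LinearMap.id_apply]
  change (3 : ℤ) • G.signSection (G.signHom (G.arc a b)) = _
  set d : G.Dart := ⟨(a, b), h⟩
  have hd : G.arc a b = G.arc d.fst d.snd := rfl
  obtain ⟨C, hC⟩ := exists_dartIn htri d
  have h3 := three_arc_eq_compSign hC
  have h0 {C'} (h : C' ≠ C) : compSign C' d = 0 := compSign_of_not fun h' => h (h'.unique hC)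
  rw [hd, signHom_arc]
  by_cases hcoh : G.IsCoherent C
  · have : ((fun C => compSign C.1 d, fun C => (compSign C.1 d : ZMod 2)) : G.SignGroup) =
        (Pi.single ⟨C, hcoh⟩ (compSign C d), 0) := by
      refine Prod.ext (funext fun C' => ?_) (funext fun C' => ?_)
      · by_cases h : C' = ⟨C, hcoh⟩
        · subst h
          simp
        · simp only [Pi.single_eq_of_ne h]
          exact h0 fun h' => h (Subtype.ext h')
      · simp [h0 (C' := C'.1) fun h' => C'.2 (h' ▸ hcoh)]
    rw [this, signSection_inl]
    have e : (3 : ℤ) • G.arc d.fst d.snd = 3 • G.arc d.fst d.snd := by module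
    rw [e, h3]
    module
  · have : ((fun C => compSign C.1 d, fun C => (compSign C.1 d : ZMod 2)) : G.SignGroup) =
        (0, Pi.single ⟨C, hcoh⟩ (compSign C d : ZMod 2)) := by
      refine Prod.ext (funext fun C' => ?_) (funext fun C' => ?_)
      · simp [h0 (C' := C'.1) fun h' => hcoh (h' ▸ C'.2)]
      · by_cases h : C' = ⟨C, hcoh⟩
        · subst h
          simp
        · simp [Pi.single_eq_of_ne h, h0 (C' := C'.1) fun h' => h (Subtype.ext h')]
    rw [this, signSection_inr]
    have e : (3 : ℤ) • G.arc d.fst d.snd = 3 • G.arc d.fst d.snd := by module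
    have h6 := six_arc_eq_zero hcoh
    rw [e, h3]
    linear_combination (norm := module) compSign C d • h6

/-- The structure of `H₁(X_Δ)`. -/
theorem edgeGroup_structure [Finite V]
    (htri : ∀ a b : V, G.Adj a b → ∃ c : V, G.Adj a c ∧ G.Adj b c) :
    ∃ n : ℕ, Nonempty (G.EdgeGroup ≃+ (Fin G.numCoherentComponents → ℤ) ×
      (Fin (Nat.card {C : G.triangleGraph.ConnectedComponent // ¬G.IsCoherent C}) → ZMod 2) ×
      (Fin n → ZMod 3)) := by
  have hK (x : LinearMap.ker G.signHom) : 3 • x = 0 := by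
    have h := G.three_signSection_signHom htri x.1
    rw [x.2, map_zero, smul_zero] at h
    exact Subtype.ext h.symm
  have : Module.Finite ℤ (G.XΔ.C₁ ℤ) := inferInstance
  have : Module.Finite ℤ (LinearMap.ker G.signHom) := inferInstance
  let : Module (ZMod 3) (LinearMap.ker G.signHom) := AddCommGroup.zmodModule hK
  have : Module.Finite (ZMod 3) (LinearMap.ker G.signHom) :=
    Module.Finite.of_restrictScalars_finite ℤ (ZMod 3) _
  have : Fact (Nat.Prime 3) := ⟨Nat.prime_three⟩
  let eK := (Module.finBasis (ZMod 3) (LinearMap.ker G.signHom)).equivFun.toAddEquiv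
  let e : G.EdgeGroup ≃+ G.SignGroup × LinearMap.ker G.signHom :=
    { toFun := fun x => (G.signHom x, ⟨x - G.signSection (G.signHom x), by
        rw [LinearMap.mem_ker, map_sub, signHom_signSection, sub_self]⟩)
      invFun := fun y => G.signSection y.1 + y.2
      left_inv := fun x => by simp
      right_inv := fun y => by
        have h : G.signHom (G.signSection y.1 + y.2) = y.1 := by
          rw [map_add, signHom_signSection, y.2.2, add_zero]
        refine Prod.ext h (Subtype.ext ?_)
        simp only [h]
        abel
      map_add' := fun x y => by
        refine Prod.ext (map_add _ _ _) (Subtype.ext ?_)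
        simp only [map_add, Prod.snd_add, Submodule.coe_add]
        abel }
  refine ⟨_, ⟨e.trans ((AddEquiv.prodAssoc).trans (AddEquiv.prodCongr ?_
    (AddEquiv.prodCongr ?_ eK)))⟩⟩
  · exact (LinearEquiv.funCongrLeft ℤ ℤ (Finite.equivFin _).symm).toAddEquiv
  · exact (LinearEquiv.funCongrLeft ℤ (ZMod 2) (Finite.equivFin _).symm).toAddEquiv

end Structure

end SimpleGraph

namespace SimpleGraph

section ModThree

variable {V : Type u} (G : SimpleGraph V)

instance [Finite V] : Finite G.hatX₃.Dart := inferInstanceAs (Finite G.Dart)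

/-- The 1-chains of `hatX₃` modulo 3, up to boundaries. -/
abbrev ChainQuotient : Type u :=
  G.hatX₃.C₁ (ZMod 3) ⧸ LinearMap.range (G.hatX₃.boundary₂ (ZMod 3))

/-- The class of an oriented edge in the 1-chains of `hatX₃` modulo 3 and boundaries. -/
def hatArc (d : G.Dart) : G.ChainQuotient :=
  (LinearMap.range (G.hatX₃.boundary₂ (ZMod 3))).mkQ (G.hatX₃.chain (ZMod 3) d)

variable {G}

theorem hatArc_symm (d : G.Dart) : G.hatArc d.symm = -G.hatArc d := by
  rw [hatArc, hatArc, ← map_neg]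
  exact congrArg _ (G.hatX₃.chain_rev (ZMod 3) d)

theorem boundary₂_hatX₃ (t : G.Triangle) :
    G.hatX₃.boundary₂ (ZMod 3) (Finsupp.single t 1) = G.hatX₃.chain (ZMod 3) t.e₁ +
      (G.hatX₃.chain (ZMod 3) t.e₂ + G.hatX₃.chain (ZMod 3) t.e₃) := by
  refine (G.hatX₃.boundary₂_single (ZMod 3) t).trans ?_
  change G.hatX₃.chain (ZMod 3) t.e₁ +
      (G.hatX₃.chain (ZMod 3) t.e₂ + (G.hatX₃.chain (ZMod 3) t.e₃ + 0)) = _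
  rw [add_zero]

theorem hatArc_corners (t : G.Triangle) :
    G.hatArc t.e₁ + G.hatArc t.e₂ + G.hatArc t.e₃ = 0 := by
  have h : (LinearMap.range (G.hatX₃.boundary₂ (ZMod 3))).mkQ
      (G.hatX₃.boundary₂ (ZMod 3) (Finsupp.single t 1)) = 0 :=
    (Submodule.Quotient.mk_eq_zero _).2 ⟨_, rfl⟩
  rw [boundary₂_hatX₃, map_add, map_add, ← add_assoc] at h
  exact h

theorem hatArc_add {a b c : V} (hab : G.Adj a b) (hbc : G.Adj b c) (hca : G.Adj c a) :
    G.hatArc ⟨(a, b), hab⟩ + G.hatArc ⟨(b, c), hbc⟩ + G.hatArc ⟨(c, a), hca⟩ = 0 := by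
  classical
  have h := corners_induction (G := G) (P := fun a b c => ∀ (hab : G.Adj a b) (hbc : G.Adj b c)
    (hca : G.Adj c a), G.hatArc ⟨(a, b), hab⟩ + G.hatArc ⟨(b, c), hbc⟩ +
      G.hatArc ⟨(c, a), hca⟩ = 0) ?_ ?_ (triangleOf hab hbc hca)
    (fun _ _ _ => hatArc_corners _) hab.ne hbc.ne hca.ne ?_ ?_ ?_
  · exact h hab hbc hca
  · intro a b c h h1 h2 h3
    rw [← h h3 h1 h2]
    abel
  · intro a b c h h1 h2 h3
    have := h h2.symm h1.symm h3.symm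
    have hs {x y : V} (h : G.Adj x y) : G.hatArc ⟨(x, y), h⟩ = -G.hatArc ⟨(y, x), h.symm⟩ :=
      hatArc_symm ⟨(y, x), h.symm⟩
    rw [← neg_eq_zero, ← this, hs h1, hs h2, hs h3]
    abel
  all_goals simp [triangleOf]

theorem three_smul_chainQuotient (x : G.ChainQuotient) : 3 • x = 0 := by
  rw [← Nat.cast_smul_eq_nsmul (ZMod 3)]
  have : ((3 : ℕ) : ZMod 3) = 0 := rfl
  rw [this, zero_smul]

open Classical in
variable (G) in
/-- The reduction modulo 3 of the edge group. -/
def edgeGroupModThree : G.EdgeGroup →ₗ[ℤ] G.ChainQuotient :=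
  edgeGroupLift (fun a b => if h : G.Adj a b then G.hatArc ⟨(a, b), h⟩ else 0)
    (fun a b h => by
      rw [dif_pos h, dif_pos h.symm, ← hatArc_symm]
      rfl)
    (fun a b c hab hbc hca => by
      rw [dif_pos hab, dif_pos hbc, dif_pos hca]
      have h1 := hatArc_add hab hbc hca
      have h2 := three_smul_chainQuotient (G.hatArc ⟨(c, a), hca⟩)
      linear_combination (norm := module) h2 - h1)

theorem edgeGroupModThree_arc (d : G.Dart) :
    G.edgeGroupModThree (G.arc d.fst d.snd) = G.hatArc d := by
  rw [edgeGroupModThree, edgeGroupLift_arc _ _ _ d.adj, dif_pos d.adj]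

theorem edgeGroupModThree_surjective : Function.Surjective G.edgeGroupModThree := by
  intro w
  obtain ⟨w, rfl⟩ := Submodule.mkQ_surjective _ w
  obtain ⟨w, rfl⟩ := Submodule.mkQ_surjective _ w
  induction w using Finsupp.induction_linear with
  | zero => exact ⟨0, by simp⟩
  | add x y hx hy =>
    obtain ⟨x', hx⟩ := hx
    obtain ⟨y', hy⟩ := hy
    exact ⟨x' + y', by rw [map_add, hx, hy, ← map_add, ← map_add]⟩
  | single d r =>
    obtain ⟨n, rfl⟩ := ZMod.intCast_surjective r
    let d' : G.Dart := d
    refine ⟨n • G.arc d'.fst d'.snd, ?_⟩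
    rw [map_zsmul, edgeGroupModThree_arc]
    change n • Submodule.mkQ _ (Submodule.mkQ _ (Finsupp.single d 1)) = _
    rw [← map_zsmul, ← map_zsmul, Finsupp.smul_single, zsmul_one]

theorem edgeGroupModThree_eq_zero {x : G.EdgeGroup} :
    G.edgeGroupModThree x = 0 ↔ ∃ y, x = 3 • y := by
  constructor
  · intro hx
    let T : Submodule ℤ G.EdgeGroup := LinearMap.range (LinearMap.lsmul ℤ G.EdgeGroup 3)
    have hT (z : G.EdgeGroup ⧸ T) : 3 • z = 0 := by
      obtain ⟨z, rfl⟩ := T.mkQ_surjective z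
      rw [← map_nsmul, Submodule.mkQ_apply, Submodule.Quotient.mk_eq_zero]
      exact ⟨z, by rw [LinearMap.lsmul_apply]; module⟩
    let : Module (ZMod 3) (G.EdgeGroup ⧸ T) := AddCommGroup.zmodModule hT
    let f : G.hatX₃.C₁ (ZMod 3) →ₗ[ZMod 3] (G.EdgeGroup ⧸ T) :=
      G.hatX₃.chainLift (R := ZMod 3) (fun d : G.Dart => T.mkQ (G.arc d.fst d.snd))
        (fun d => (congrArg T.mkQ (arc_symm _ _)).trans (map_neg _ _))
    have hf (d : G.Dart) : f (G.hatX₃.chain (ZMod 3) d) = T.mkQ (G.arc d.fst d.snd) :=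
      G.hatX₃.chainLift_chain (R := ZMod 3) _ _ d
    let s : G.ChainQuotient →ₗ[ZMod 3] (G.EdgeGroup ⧸ T) :=
      (LinearMap.range (G.hatX₃.boundary₂ (ZMod 3))).liftQ f (by
        rw [LinearMap.range_le_ker_iff]
        refine Finsupp.lhom_ext' fun t => LinearMap.ext_ring ?_
        refine (congrArg f (boundary₂_hatX₃ t)).trans ?_
        rw [LinearMap.zero_comp, LinearMap.zero_apply, map_add, map_add, hf, hf, hf, ← map_add, ← map_add,
          Submodule.mkQ_apply, Submodule.Quotient.mk_eq_zero]
        have hs := Triangle.corners_spec t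
        refine ⟨G.arc (Triangle.e₃ t).fst (Triangle.e₃ t).snd, ?_⟩
        have := two_arc hs.1 hs.2.1 hs.2.2.1
        change (3 : ℤ) • G.arc (Triangle.corners t).2.2 (Triangle.corners t).1 =
          G.arc (Triangle.corners t).1 (Triangle.corners t).2.1 +
          (G.arc (Triangle.corners t).2.1 (Triangle.corners t).2.2 +
          G.arc (Triangle.corners t).2.2 (Triangle.corners t).1)
        linear_combination (norm := module) this)
    have hs : s.toAddMonoidHom.toIntLinearMap ∘ₗ G.edgeGroupModThree = T.mkQ := by
      refine edgeGroup_hom_ext fun a b h => ?_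
      rw [LinearMap.comp_apply]
      refine (congrArg s (edgeGroupModThree_arc ⟨(a, b), h⟩)).trans ?_
      exact hf _
    have h0 := LinearMap.congr_fun hs x
    rw [LinearMap.comp_apply, hx, map_zero, eq_comm, Submodule.mkQ_apply,
      Submodule.Quotient.mk_eq_zero] at h0
    obtain ⟨y, rfl⟩ := h0
    exact ⟨y, by rw [LinearMap.lsmul_apply]; module⟩
  · rintro ⟨y, rfl⟩
    rw [map_nsmul, three_smul_chainQuotient]

theorem finrank_chainQuotient_eq [Finite V] {c k n : ℕ}
    (e : G.EdgeGroup ≃+ (Fin c → ℤ) × (Fin k → ZMod 2) × (Fin n → ZMod 3)) :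
    Module.finrank (ZMod 3) G.ChainQuotient = c + n := by
  let p : (Fin c → ℤ) × (Fin k → ZMod 2) × (Fin n → ZMod 3) →+
      (Fin c → ZMod 3) × (Fin n → ZMod 3) :=
    { toFun := fun x => (fun i => (x.1 i : ZMod 3), x.2.2)
      map_zero' := by ext <;> simp
      map_add' := fun x y => by ext <;> simp }
  have hp : Function.Surjective p := by
    rintro ⟨x, y⟩
    choose x' hx' using fun i => ZMod.intCast_surjective (x i)
    exact ⟨(x', 0, y), by ext <;> simp [p, hx']⟩
  let q : (Fin c → ℤ) × (Fin k → ZMod 2) × (Fin n → ZMod 3) →+ G.ChainQuotient :=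
    G.edgeGroupModThree.toAddMonoidHom.comp e.symm.toAddMonoidHom
  have hq : Function.Surjective q := edgeGroupModThree_surjective.comp e.symm.surjective
  have h3 (y : Fin n → ZMod 3) : 3 • y = 0 := by
    ext i
    rw [Pi.smul_apply, nsmul_eq_mul]
    exact zero_mul _
  have h2 (y : Fin k → ZMod 2) : 3 • y = y := by
    ext i
    rw [Pi.smul_apply, nsmul_eq_mul]
    exact one_mul _
  have hk : p.ker = q.ker := by
    ext x
    rw [AddMonoidHom.mem_ker, AddMonoidHom.mem_ker]
    have hqx : q x = 0 ↔ ∃ y, e.symm x = 3 • y := edgeGroupModThree_eq_zero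
    rw [hqx]
    constructor
    · intro hx
      have h1 (i) : ∃ z, x.1 i = 3 * z :=
        (ZMod.intCast_zmod_eq_zero_iff_dvd _ 3).1 (congrFun (congrArg Prod.fst hx) i)
      choose z hz using h1
      have h1 : x.2.2 = 0 := congrArg Prod.snd hx
      refine ⟨e.symm (z, x.2.1, 0), ?_⟩
      rw [← map_nsmul]
      congr 1
      refine Prod.ext (funext fun i => ?_) (Prod.ext (h2 _).symm ?_)
      · simp [hz]
      · simp [h1]
    · rintro ⟨y, hy⟩
      have : x = 3 • e y := by rw [← map_nsmul, ← hy, e.apply_symm_apply]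
      rw [this]
      refine Prod.ext (funext fun i => ?_) (h3 _)
      change (((3 • e y).1 i : ℤ) : ZMod 3) = 0
      rw [ZMod.intCast_zmod_eq_zero_iff_dvd]
      exact ⟨(e y).1 i, by simp⟩
  have eW : G.ChainQuotient ≃+ (Fin c → ZMod 3) × (Fin n → ZMod 3) :=
    (QuotientAddGroup.quotientKerEquivOfSurjective q hq).symm.trans
      ((QuotientAddGroup.quotientAddEquivOfEq hk.symm).trans
        (QuotientAddGroup.quotientKerEquivOfSurjective p hp))
  have h := Nat.card_congr eW.toEquiv
  rw [Module.natCard_eq_pow_finrank (K := ZMod 3)] at h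
  rw [Nat.card_prod, Nat.card_fun, Nat.card_fun, Nat.card_zmod, Nat.card_fin, Nat.card_fin,
    ← pow_add] at h
  exact Nat.pow_right_injective (by norm_num : 2 ≤ 3) h

theorem finrank_range_boundary₁ [Finite V] (hconn : G.Connected) :
    Module.finrank (ZMod 3) (LinearMap.range (G.hatX₃.boundary₁ (ZMod 3))) + 1 =
      Nat.card V := by
  let ε : (V →₀ ZMod 3) →ₗ[ZMod 3] ZMod 3 := Finsupp.linearCombination (ZMod 3) fun _ => 1
  let B : G.hatX₃.C₁ (ZMod 3) →ₗ[ZMod 3] (V →₀ ZMod 3) := G.hatX₃.boundary₁ (ZMod 3)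
  change Module.finrank (ZMod 3) (LinearMap.range B) + 1 = Nat.card V
  obtain ⟨v₀⟩ := hconn.nonempty
  have hε : Function.Surjective ε := fun r => ⟨Finsupp.single v₀ r, by simp [ε]⟩
  have hb (d : G.Dart) : B (G.hatX₃.chain (ZMod 3) d) =
      Finsupp.single d.snd 1 - Finsupp.single d.fst 1 :=
    G.hatX₃.boundary₁_chain (ZMod 3) d
  have hwalk (w : V) : (Finsupp.single w 1 - Finsupp.single v₀ 1 : V →₀ ZMod 3) ∈
      LinearMap.range B := by
    have hr := hconn.preconnected v₀ w
    rw [reachable_iff_reflTransGen] at hr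
    induction hr with
    | refl =>
      rw [sub_self]
      exact zero_mem _
    | @tail x y _ hxy ih =>
      have h1 : (Finsupp.single y 1 - Finsupp.single x 1 : V →₀ ZMod 3) ∈
          LinearMap.range B := ⟨_, hb ⟨(x, y), hxy⟩⟩
      have h2 := add_mem h1 ih
      rwa [sub_add_sub_cancel] at h2
  have hker : LinearMap.range B = LinearMap.ker ε := by
    apply le_antisymm
    · rw [LinearMap.range_le_ker_iff]
      refine CellComplex.C₁_hom_ext _ fun d => ?_
      refine (congrArg ε (hb d)).trans ?_
      rw [map_sub]
      simp [ε]
    · intro x hx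
      have key (x : V →₀ ZMod 3) : x - Finsupp.single v₀ (ε x) ∈
          LinearMap.range B := by
        induction x using Finsupp.induction_linear with
        | zero =>
          rw [map_zero, Finsupp.single_zero, sub_zero]
          exact zero_mem _
        | add x y hx hy =>
          have := add_mem hx hy
          rwa [sub_add_sub_comm, ← Finsupp.single_add, ← map_add] at this
        | single w r =>
          have h1 := Submodule.smul_mem _ r (hwalk w)
          rw [smul_sub, Finsupp.smul_single_one, Finsupp.smul_single_one] at h1
          have h2 : ε (Finsupp.single w r) = r := by simp [ε]
          rwa [h2]
      have := key x
      rw [LinearMap.mem_ker] at hx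
      rwa [hx, Finsupp.single_zero, sub_zero] at this
  have h1 := LinearMap.finrank_range_add_finrank_ker ε
  rw [LinearMap.range_eq_top.2 hε, finrank_top, Module.finrank_self] at h1
  have := Fintype.ofFinite V
  have h2 : Module.finrank (ZMod 3) (V →₀ ZMod 3) = Nat.card V := by
    rw [Nat.card_eq_fintype_card]
    exact Module.finrank_finsupp_self (ZMod 3) (ι := V)
  rw [hker]
  omega

theorem boundary₁_comp_boundary₂_hatX₃ :
    G.hatX₃.boundary₁ (ZMod 3) ∘ₗ G.hatX₃.boundary₂ (ZMod 3) = 0 := by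
  refine Finsupp.lhom_ext' fun t => LinearMap.ext_ring ?_
  refine (congrArg (G.hatX₃.boundary₁ (ZMod 3)) (boundary₂_hatX₃ t)).trans ?_
  have hb (d : G.Dart) : G.hatX₃.boundary₁ (ZMod 3) (G.hatX₃.chain (ZMod 3) d) =
      Finsupp.single d.snd 1 - Finsupp.single d.fst 1 :=
    G.hatX₃.boundary₁_chain (ZMod 3) d
  rw [map_add, map_add, hb, hb, hb]
  simp only [Triangle.e₁, Triangle.e₂, Triangle.e₃, LinearMap.zero_comp, LinearMap.zero_apply]
  abel

theorem finrank_chainQuotient [Finite V] (hconn : G.Connected) :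
    Module.finrank (ZMod 3) G.ChainQuotient + 1 =
      Nat.card V + Module.finrank (ZMod 3) (G.hatX₃.H₁ (ZMod 3)) := by
  have h1 : Module.finrank (ZMod 3) G.ChainQuotient + _ = _ :=
    Submodule.finrank_quotient_add_finrank (LinearMap.range (G.hatX₃.boundary₂ (ZMod 3)))
  have h2 := LinearMap.finrank_range_add_finrank_ker (G.hatX₃.boundary₁ (ZMod 3))
  have h3 : Module.finrank (ZMod 3) (G.hatX₃.H₁ (ZMod 3)) + _ = _ :=
    Submodule.finrank_quotient_add_finrank
      ((LinearMap.range (G.hatX₃.boundary₂ (ZMod 3))).comap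
        (LinearMap.ker (G.hatX₃.boundary₁ (ZMod 3))).subtype)
  have h4 := (Submodule.comapSubtypeEquivOfLe (LinearMap.range_le_ker_iff.2
    (boundary₁_comp_boundary₂_hatX₃ (G := G)))).finrank_eq
  have h5 := finrank_range_boundary₁ hconn
  omega

end ModThree

end SimpleGraph

namespace SimpleGraph

section Matrix

variable {V : Type u} (G : SimpleGraph V)

/-- The component of a vertex in `[G : s]`. -/
abbrev stateMk (s : Finset G.edgeSet) (x : V) : G.StateComp s :=
  (G.stateGraph s).connectedComponentMk x

variable {G} in
theorem stateMk_singleton_eq {e : G.edgeSet} {x y : V} :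
    G.stateMk {e} x = G.stateMk {e} y ↔ x = y ∨ x ∈ e.1 ∧ y ∈ e.1 := by
  constructor
  · intro h
    have hr := ConnectedComponent.exact h
    rw [reachable_iff_reflTransGen] at hr
    induction hr with
    | refl => exact .inl rfl
    | @tail y z hxy hyz ih =>
      have hyz' : s(y, z) = e.1 := by simpa [stateGraph, hyz.ne] using hyz
      have h1 := ih (ConnectedComponent.sound (by rwa [reachable_iff_reflTransGen]))
      rw [← hyz'] at h1 ⊢
      rcases h1 with rfl | h1
      · exact .inr (by simp)
      · exact .inr ⟨h1.1, by simp⟩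
  · rintro (rfl | ⟨hx, hy⟩)
    · rfl
    · by_cases hxy : x = y
      · rw [hxy]
      · refine ConnectedComponent.sound (Adj.reachable ?_)
        simp [stateGraph, hxy, ((Sym2.mem_and_mem_iff hxy).1 ⟨hx, hy⟩).symm]

/-- The states with one edge, together with a component. -/
abbrev StateRow : Type u := Σ e : G.edgeSet, G.StateComp {e}

variable (V) in
/-- The triples of vertices and the ordered pairs of distinct vertices. -/
abbrev StateCol : Type u := {T : Finset V // T.card = 3} ⊕ {p : V × V // p.1 ≠ p.2}

open Classical in
/-- The matrix of the coboundary of degree `2v - 3`: triples and ordered pairs index the monomials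
with deficits `1, 1, 1` and `2, 1`. -/
def stateMatrix : Matrix G.StateRow (StateCol V) ℤ := fun r c => match c with
  | .inl T => if (∀ x ∈ r.1.1, x ∈ T.1) ∧ ∃ w ∈ T.1, w ∉ r.1.1 ∧ r.2 = G.stateMk _ w then 1 else 0
  | .inr p => if p.1.1 ∈ r.1.1 ∧ r.2 = G.stateMk _ p.1.2 then 1 else 0

/-- `T` consists of `a`, `b` and `w`. -/
def IsTriple (T : Finset V) (a b w : V) : Prop := ∀ x, x ∈ T ↔ x = a ∨ x = b ∨ x = w

variable {G}

theorem exists_isTriple {a b w : V} (hab : a ≠ b) (haw : a ≠ w) (hbw : b ≠ w) :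
    ∃ T : {T : Finset V // T.card = 3}, IsTriple T.1 a b w := by
  classical
  exact ⟨⟨{a, b, w}, Finset.card_eq_three.2 ⟨a, b, w, hab, haw, hbw, rfl⟩⟩, fun x => by simp⟩

open Classical in
theorem stateMatrix_row {a b w : V} (hab : G.Adj a b) (haw : a ≠ w) (hbw : b ≠ w)
    (T : {T : Finset V // T.card = 3}) (hT : IsTriple T.1 a b w) :
    G.stateMatrix ⟨⟨s(a, b), hab⟩, G.stateMk _ w⟩ = Pi.single (.inl T) 1 +
      (Pi.single (.inr ⟨(a, w), haw⟩) 1 + Pi.single (.inr ⟨(b, w), hbw⟩) 1) := by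
  funext c
  rcases c with T' | ⟨⟨x, y⟩, hxy⟩
  · have : ((∀ x ∈ s(a, b), x ∈ T'.1) ∧ ∃ z ∈ T'.1, z ∉ s(a, b) ∧
        G.stateMk {⟨s(a, b), hab⟩} w = G.stateMk _ z) ↔ T' = T := by
      simp only [stateMk_singleton_eq, Sym2.mem_iff]
      constructor
      · rintro ⟨h1, z, h2, h3, h4⟩
        have h5 : w = z := h4.resolve_right fun h => h3 h.2
        subst h5
        apply Subtype.ext
        refine (Finset.eq_of_subset_of_card_le (s := T.1) (t := T'.1) (fun x hx => ?_) ?_).symm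
        · rcases (hT x).1 hx with rfl | rfl | rfl
          exacts [h1 _ (.inl rfl), h1 _ (.inr rfl), h2]
        · rw [T.2, T'.2]
      · rintro rfl
        refine ⟨fun x hx => (hT x).2 (by tauto), w, (hT w).2 (by tauto), ?_, .inl rfl⟩
        rintro (h | h)
        exacts [haw h.symm, hbw h.symm]
    simp only [stateMatrix, this, Pi.add_apply, Pi.single_apply, Sum.inl.injEq, reduceCtorEq,
      if_false, add_zero]
  · have : G.stateMk {⟨s(a, b), hab⟩} w = G.stateMk _ y ↔ w = y := by
      rw [stateMk_singleton_eq, Sym2.mem_iff]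
      exact ⟨fun h => h.resolve_right fun h => h.1.elim (fun h => haw h.symm) fun h => hbw h.symm,
        .inl⟩
    have h0 : a ≠ b := hab.ne
    simp only [stateMatrix, Sym2.mem_iff, this, Pi.add_apply, Pi.single_apply, reduceCtorEq,
      if_false, Sum.inr.injEq, Subtype.mk.injEq, Prod.mk.injEq, zero_add]
    by_cases h1 : w = y
    · subst h1
      by_cases h2 : x = a
      · subst h2
        simp [h0]
      · simp [h2]
    · simp [h1, Ne.symm h1]

open Classical in
theorem stateMatrix_row_self {a b : V} (hab : G.Adj a b) :
    G.stateMatrix ⟨⟨s(a, b), hab⟩, G.stateMk _ a⟩ =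
      Pi.single (.inr ⟨(a, b), hab.ne⟩) 1 + Pi.single (.inr ⟨(b, a), hab.ne'⟩) 1 := by
  funext c
  have h0 : a ≠ b := hab.ne
  rcases c with T' | ⟨⟨x, y⟩, hxy⟩
  · have : ¬((∀ x ∈ s(a, b), x ∈ T'.1) ∧ ∃ z ∈ T'.1, z ∉ s(a, b) ∧
        G.stateMk {⟨s(a, b), hab⟩} a = G.stateMk _ z) := by
      simp only [stateMk_singleton_eq, Sym2.mem_iff]
      rintro ⟨-, z, -, h1, h2⟩
      rcases h2 with rfl | h2
      · exact h1 (.inl rfl)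
      · exact h1 h2.2
    simp only [stateMatrix, this, Pi.add_apply, Pi.single_apply, reduceCtorEq, if_false,
      add_zero]
  · have : G.stateMk {⟨s(a, b), hab⟩} a = G.stateMk _ y ↔ y = a ∨ y = b := by
      rw [stateMk_singleton_eq, Sym2.mem_iff, Sym2.mem_iff]
      constructor
      · rintro (h | h)
        exacts [.inl h.symm, h.2]
      · exact fun h => .inr ⟨.inl rfl, h⟩
    simp only [stateMatrix, Sym2.mem_iff, this, Pi.add_apply, Pi.single_apply,
      Sum.inr.injEq, Subtype.mk.injEq, Prod.mk.injEq]
    have hxy' : x ≠ y := hxy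
    split_ifs <;> grind

theorem stateRow_cases (r : G.StateRow) :
    (∃ (a b w : V) (hab : G.Adj a b), a ≠ w ∧ b ≠ w ∧
      r = ⟨⟨s(a, b), hab⟩, G.stateMk _ w⟩) ∨
    ∃ (a b : V) (hab : G.Adj a b), r = ⟨⟨s(a, b), hab⟩, G.stateMk _ a⟩ := by
  obtain ⟨⟨e, he⟩, c⟩ := r
  induction c using ConnectedComponent.ind with
  | h w =>
    induction e with
    | h a b =>
      by_cases h : w = a ∨ w = b
      · right
        refine ⟨a, b, he, ?_⟩
        have : G.stateMk {⟨s(a, b), he⟩} w = G.stateMk _ a :=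
          stateMk_singleton_eq.2 (.inr ⟨by simpa using h, by simp⟩)
        exact congrArg _ this
      · push Not at h
        exact .inl ⟨a, b, w, he, h.1.symm, h.2.symm, rfl⟩

variable (G)

/-- The cokernel of the transpose of `stateMatrix`. -/
abbrev DualCoker : Type u := (StateCol V → ℤ) ⧸ Submodule.span ℤ (Set.range G.stateMatrix)

open Classical in
/-- The generator given by a triple of vertices. -/
def tripleGen (T : {T : Finset V // T.card = 3}) : G.DualCoker :=
  Submodule.mkQ _ (Pi.single (.inl T) 1)

open Classical in
/-- The generator given by an ordered pair of distinct vertices. -/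
def pairGen (a b : V) : G.DualCoker :=
  if h : a ≠ b then Submodule.mkQ _ (Pi.single (.inr ⟨(a, b), h⟩) 1) else 0

variable {G}

theorem tripleGen_add {a b w : V} (hab : G.Adj a b) (haw : a ≠ w) (hbw : b ≠ w)
    (T : {T : Finset V // T.card = 3}) (hT : IsTriple T.1 a b w) :
    G.tripleGen T + (G.pairGen a w + G.pairGen b w) = 0 := by
  classical
  rw [tripleGen, pairGen, pairGen, dif_pos haw, dif_pos hbw, ← map_add, ← map_add,
    ← stateMatrix_row hab haw hbw T hT, Submodule.mkQ_apply, Submodule.Quotient.mk_eq_zero]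
  exact Submodule.subset_span ⟨_, rfl⟩

theorem pairGen_add {a b : V} (hab : G.Adj a b) : G.pairGen a b + G.pairGen b a = 0 := by
  classical
  rw [pairGen, pairGen, dif_pos hab.ne, dif_pos hab.ne', ← map_add, ← stateMatrix_row_self hab,
    Submodule.mkQ_apply, Submodule.Quotient.mk_eq_zero]
  exact Submodule.subset_span ⟨_, rfl⟩

theorem pairGen_swap {a b w : V} (hab : G.Adj a b) (hbw : G.Adj b w) (haw : a ≠ w) :
    G.pairGen a w + G.pairGen b w = G.pairGen w a + G.pairGen b a := by
  obtain ⟨T, hT⟩ := exists_isTriple hab.ne haw hbw.ne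
  have hT' : IsTriple T.1 w b a := fun x => (hT x).trans (by tauto)
  have h1 := tripleGen_add hab haw hbw.ne T hT
  have h2 := tripleGen_add hbw.symm haw.symm hab.ne' T hT'
  linear_combination (norm := module) h1 - h2

variable {A : Type*} [AddCommGroup A] [Finite V]

theorem dualCoker_hom_ext {f g : G.DualCoker →ₗ[ℤ] A}
    (h1 : ∀ T, f (G.tripleGen T) = g (G.tripleGen T))
    (h2 : ∀ a b, a ≠ b → f (G.pairGen a b) = g (G.pairGen a b)) : f = g := by
  classical
  refine Submodule.linearMap_qext _ (LinearMap.pi_ext' fun c => LinearMap.ext_ring ?_)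
  rcases c with T | ⟨⟨x, y⟩, hxy⟩
  · exact h1 T
  · have := h2 x y hxy
    rwa [pairGen, dif_pos hxy] at this

open Classical in
/-- The homomorphism on `DualCoker` with given values on the generators. -/
def dualCokerLift (gT : {T : Finset V // T.card = 3} → A) (gp : V → V → A)
    (h1 : ∀ a b w, G.Adj a b → a ≠ w → b ≠ w → ∀ T : {T : Finset V // T.card = 3},
      IsTriple T.1 a b w → gT T + (gp a w + gp b w) = 0)
    (h2 : ∀ a b, G.Adj a b → gp a b + gp b a = 0) : G.DualCoker →ₗ[ℤ] A :=
  (Submodule.span ℤ (Set.range G.stateMatrix)).liftQ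
    ((Pi.basisFun ℤ (StateCol V)).constr ℤ (Sum.elim gT fun p => gp p.1.1 p.1.2)) (by
      rw [Submodule.span_le]
      have hs (c : StateCol V) : (Pi.basisFun ℤ (StateCol V)).constr ℤ
          (Sum.elim gT fun p => gp p.1.1 p.1.2) (Pi.single c 1) =
          (Sum.elim gT (fun p => gp p.1.1 p.1.2) c : A) := by
        rw [← Pi.basisFun_apply, Module.Basis.constr_basis]
      rintro _ ⟨r, rfl⟩
      rw [SetLike.mem_coe, LinearMap.mem_ker]
      rcases stateRow_cases r with ⟨a, b, w, hab, haw, hbw, rfl⟩ | ⟨a, b, hab, rfl⟩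
      · obtain ⟨T, hT⟩ := exists_isTriple hab.ne haw hbw
        rw [stateMatrix_row hab haw hbw T hT, map_add, map_add, hs, hs, hs]
        exact h1 a b w hab haw hbw T hT
      · rw [stateMatrix_row_self, map_add, hs, hs]
        exact h2 a b hab)

variable (gT : {T : Finset V // T.card = 3} → A) (gp : V → V → A)
    (h1 : ∀ a b w, G.Adj a b → a ≠ w → b ≠ w → ∀ T : {T : Finset V // T.card = 3},
      IsTriple T.1 a b w → gT T + (gp a w + gp b w) = 0)
    (h2 : ∀ a b, G.Adj a b → gp a b + gp b a = 0)

theorem dualCokerLift_tripleGen (T) :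
    dualCokerLift gT gp h1 h2 (G.tripleGen T) = gT T := by
  classical
  rw [dualCokerLift, tripleGen, Submodule.mkQ_apply, Submodule.liftQ_apply]
  convert (Pi.basisFun ℤ (StateCol V)).constr_basis ℤ (Sum.elim gT fun p => gp p.1.1 p.1.2) (.inl T)
    using 2
  · rw [Pi.basisFun_apply]
  · rfl

theorem dualCokerLift_pairGen {a b : V} (h : a ≠ b) :
    dualCokerLift gT gp h1 h2 (G.pairGen a b) = gp a b := by
  classical
  rw [dualCokerLift, pairGen, dif_pos h, Submodule.mkQ_apply, Submodule.liftQ_apply]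
  convert (Pi.basisFun ℤ (StateCol V)).constr_basis ℤ (Sum.elim gT fun p => gp p.1.1 p.1.2)
    (.inr ⟨(a, b), h⟩) using 2
  · rw [Pi.basisFun_apply]
  · rfl

end Matrix

end SimpleGraph

namespace SimpleGraph

section DualCokerStructure

variable {V : Type u} (G : SimpleGraph V) (r : V → V → Prop)

/-- The index set of the free part of `DualCoker`: the triples without edges and the pairs of
distinct non-adjacent vertices, where only one of the two orders counts for vertices with a common
neighbour. -/
abbrev FreeIndex : Type u :=
  {T : {T : Finset V // T.card = 3} // ∀ a ∈ T.1, ∀ b ∈ T.1, ¬G.Adj a b} ⊕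
    {p : V × V // (p.1 ≠ p.2 ∧ ¬G.Adj p.1 p.2) ∧ ((∃ z, G.Adj p.1 z ∧ G.Adj z p.2) → r p.1 p.2)}

open Classical in
/-- The difference of the two edges of a path of length two. -/
def pathDiff (a b : V) : G.EdgeGroup :=
  if h : ∃ z, G.Adj a z ∧ G.Adj z b then G.arc h.choose a - G.arc h.choose b else 0

variable {G} in
theorem pathDiff_eq (hsq : G.IsSquareCordial) {a b z : V} (hab : a ≠ b) (hn : ¬G.Adj a b)
    (haz : G.Adj a z) (hzb : G.Adj z b) : G.pathDiff a b = G.arc z a - G.arc z b := by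
  have h : ∃ z, G.Adj a z ∧ G.Adj z b := ⟨z, haz, hzb⟩
  rw [pathDiff, dif_pos h]
  obtain ⟨h1, h2⟩ := h.choose_spec
  generalize h.choose = y at h1 h2
  by_cases hyz : y = z
  · rw [hyz]
  · have hyz' : G.Adj y z :=
      (hsq a y b z h1 h2 hzb.symm haz.symm hab hyz).resolve_left hn
    have e1 := two_arc h1 hyz' haz.symm
    have e2 := two_arc hyz' haz.symm h1
    have e3 := two_arc haz.symm h1 hyz'
    have e4 := two_arc h2.symm hyz' hzb
    have e5 := two_arc hyz' hzb h2.symm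
    have e6 := two_arc hzb h2.symm hyz'
    rw [arc_symm a y, arc_symm b y]
    rw [arc_symm b z] at e4 e5 e6
    rw [arc_symm b z]
    linear_combination (norm := module) e3 - e6

open Classical in
/-- The image of a pair of vertices in the sum of the edge group and the free part. -/
def pairVal (a b : V) : G.EdgeGroup × (FreeIndex G r → ℤ) :=
  if G.Adj a b then (G.arc a b, 0)
  else if h : (a ≠ b ∧ ¬G.Adj a b) ∧ ((∃ z, G.Adj a z ∧ G.Adj z b) → r a b) then
    (0, Pi.single (.inr ⟨(a, b), h⟩) 1)
  else if h : (b ≠ a ∧ ¬G.Adj b a) ∧ ((∃ z, G.Adj b z ∧ G.Adj z a) → r b a) then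
    (G.pathDiff a b, Pi.single (.inr ⟨(b, a), h⟩) 1)
  else 0

open Classical in
/-- The image of a triple of vertices in the sum of the edge group and the free part. -/
def tripleVal (T : {T : Finset V // T.card = 3}) : G.EdgeGroup × (FreeIndex G r → ℤ) :=
  if h : ∃ p : V × V × V, G.Adj p.1 p.2.1 ∧ p.1 ≠ p.2.2 ∧ p.2.1 ≠ p.2.2 ∧
      IsTriple T.1 p.1 p.2.1 p.2.2 then
    -(pairVal G r h.choose.1 h.choose.2.2 + pairVal G r h.choose.2.1 h.choose.2.2)
  else if h : ∀ a ∈ T.1, ∀ b ∈ T.1, ¬G.Adj a b then (0, Pi.single (.inl ⟨T, h⟩) 1)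
  else 0

variable {G r}

theorem pairVal_of_adj {a b : V} (h : G.Adj a b) : pairVal G r a b = (G.arc a b, 0) := if_pos h

open Classical in
theorem pairVal_of_free {a b : V}
    (h : (a ≠ b ∧ ¬G.Adj a b) ∧ ((∃ z, G.Adj a z ∧ G.Adj z b) → r a b)) :
    pairVal G r a b = (0, Pi.single (.inr ⟨(a, b), h⟩) 1) := by
  rw [pairVal, if_neg h.1.2, dif_pos h]

open Classical in
theorem pairVal_of_path (hr : ∀ a b, a ≠ b → (r a b ↔ ¬r b a)) {a b z : V} (hab : a ≠ b)
    (hn : ¬G.Adj a b) (haz : G.Adj a z) (hzb : G.Adj z b) (h : r b a) :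
    pairVal G r a b = (G.pathDiff a b, Pi.single
      (.inr ⟨(b, a), ⟨hab.symm, fun h => hn h.symm⟩, fun _ => h⟩) 1) := by
  rw [pairVal, if_neg hn, dif_neg, dif_pos ⟨⟨hab.symm, fun h => hn h.symm⟩, fun _ => h⟩]
  exact fun h' => (hr a b hab).1 (h'.2 ⟨z, haz, hzb⟩) h

theorem pairVal_swap (hr : ∀ a b, a ≠ b → (r a b ↔ ¬r b a)) (hsq : G.IsSquareCordial) {a b w : V}
    (hab : G.Adj a b) (hbw : G.Adj b w) (haw : a ≠ w) :
    pairVal G r a w + pairVal G r b w = pairVal G r w a + pairVal G r b a := by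
  classical
  by_cases h : G.Adj a w
  · rw [pairVal_of_adj h, pairVal_of_adj h.symm, pairVal_of_adj hbw, pairVal_of_adj hab.symm]
    refine Prod.ext ?_ rfl
    have := two_arc hbw.symm hab.symm h
    simp only [Prod.fst_add]
    rw [arc_symm a w, arc_symm w b]
    linear_combination (norm := module) this
  · have key {a w : V} (hab : G.Adj a b) (hbw : G.Adj b w) (haw : a ≠ w) (h : ¬G.Adj a w)
        (hlt : r a w) :
        pairVal G r a w + pairVal G r b w = pairVal G r w a + pairVal G r b a := by
      rw [pairVal_of_adj hbw, pairVal_of_adj hab.symm,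
        pairVal_of_free ⟨⟨haw, h⟩, fun _ => hlt⟩,
        pairVal_of_path hr haw.symm (fun h' => h h'.symm) hbw.symm hab.symm hlt,
        pathDiff_eq hsq haw.symm (fun h' => h h'.symm) hbw.symm hab.symm]
      refine Prod.ext ?_ rfl
      simp
    by_cases hlt : r a w
    · exact key hab hbw haw h hlt
    · exact (key hbw.symm hab.symm haw.symm (fun h' => h h'.symm)
        ((hr w a haw.symm).2 hlt)).symm

theorem tripleVal_eq (hr : ∀ a b, a ≠ b → (r a b ↔ ¬r b a)) (hsq : G.IsSquareCordial)
    {a b w : V} (hab : G.Adj a b) (haw : a ≠ w) (hbw : b ≠ w)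
    (T : {T : Finset V // T.card = 3}) (hT : IsTriple T.1 a b w) :
    tripleVal G r T + (pairVal G r a w + pairVal G r b w) = 0 := by
  have h : ∃ p : V × V × V, G.Adj p.1 p.2.1 ∧ p.1 ≠ p.2.2 ∧ p.2.1 ≠ p.2.2 ∧
      IsTriple T.1 p.1 p.2.1 p.2.2 := ⟨(a, b, w), hab, haw, hbw, hT⟩
  rw [tripleVal, dif_pos h, neg_add_eq_zero]
  obtain ⟨h1, h2, h3, h4⟩ := h.choose_spec
  generalize h.choose = p at h1 h2 h3 h4
  obtain ⟨x, y, z⟩ := p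
  dsimp only at h1 h2 h3 h4 ⊢
  have hx := (hT x).1 ((h4 x).2 (by simp))
  have hy := (hT y).1 ((h4 y).2 (by simp))
  have hz := (hT z).1 ((h4 z).2 (by simp))
  have hne := h1.ne
  have h1' := h1.symm
  have hs1 := fun h : G.Adj b w => pairVal_swap (r := r) hr hsq hab h haw
  have hs2 := fun h : G.Adj a w => pairVal_swap (r := r) hr hsq hab.symm h hbw
  rcases hz with rfl | rfl | rfl
  · have hbw' : G.Adj b w ∧ (x = b ∧ y = w ∨ x = w ∧ y = b) := by
      clear hs1 hs2
      grind
    rw [hs1 hbw'.1]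
    rcases hbw'.2 with ⟨rfl, rfl⟩ | ⟨rfl, rfl⟩
    exacts [add_comm _ _, rfl]
  · have haw' : G.Adj a w ∧ (x = a ∧ y = w ∨ x = w ∧ y = a) := by
      clear hs1 hs2
      grind
    rw [add_comm (pairVal G r a w), hs2 haw'.1]
    rcases haw'.2 with ⟨rfl, rfl⟩ | ⟨rfl, rfl⟩
    exacts [add_comm _ _, rfl]
  · have h' : x = a ∧ y = b ∨ x = b ∧ y = a := by
      clear hs1 hs2
      grind
    rcases h' with ⟨rfl, rfl⟩ | ⟨rfl, rfl⟩
    exacts [rfl, add_comm _ _]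

open Classical in
theorem tripleVal_of_free (T : {T : Finset V // T.card = 3})
    (h : ∀ a ∈ T.1, ∀ b ∈ T.1, ¬G.Adj a b) :
    tripleVal G r T = (0, Pi.single (.inl ⟨T, h⟩) 1) := by
  rw [tripleVal, dif_neg, dif_pos h]
  rintro ⟨p, h1, -, -, h2⟩
  exact h _ ((h2 _).2 (by simp)) _ ((h2 _).2 (by simp)) h1

/-- The homomorphism from the edge group to the cokernel of the transposed matrix. -/
def edgeGroupToDualCoker : G.EdgeGroup →ₗ[ℤ] G.DualCoker :=
  edgeGroupLift G.pairGen (fun a b h => by rw [eq_neg_iff_add_eq_zero, pairGen_add h.symm])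
    (fun a b c hab hbc hca => by
      have h1 := pairGen_swap hab hbc hca.ne'
      have h2 := pairGen_add hab
      have h3 := pairGen_add hca
      linear_combination (norm := module) h3 - h1 - h2)

theorem exists_isTriple_of_adj {T : Finset V} (hT : T.card = 3) {a b : V} (ha : a ∈ T)
    (hb : b ∈ T) (hab : a ≠ b) : ∃ w, a ≠ w ∧ b ≠ w ∧ IsTriple T a b w := by
  classical
  obtain ⟨w, hw⟩ := Finset.card_eq_one.1 (show (T \ {a, b}).card = 1 by
    rw [Finset.card_sdiff_of_subset (by simp [Finset.insert_subset_iff, ha, hb]), hT,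
      Finset.card_pair hab])
  have hw' (x) : (x ∈ T ∧ x ≠ a ∧ x ≠ b) ↔ x = w := by
    rw [← Finset.mem_singleton, ← hw]
    simp
  have := (hw' w).2 rfl
  refine ⟨w, this.2.1.symm, this.2.2.symm, fun x => ?_⟩
  constructor
  · intro hx
    by_contra! h
    exact h.2.2 ((hw' x).1 ⟨hx, h.1, h.2.1⟩)
  · rintro (rfl | rfl | rfl)
    exacts [ha, hb, this.1]

/-- The cokernel of the transposed matrix is the sum of the edge group and a free group. -/
theorem dualCoker_equiv [Finite V] (hr : ∀ a b, a ≠ b → (r a b ↔ ¬r b a))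
    (hsq : G.IsSquareCordial) :
    Nonempty (G.DualCoker ≃+ G.EdgeGroup × (FreeIndex G r → ℤ)) := by
  classical
  let φ : G.DualCoker →ₗ[ℤ] G.EdgeGroup × (FreeIndex G r → ℤ) :=
    dualCokerLift (tripleVal G r) (pairVal G r)
      (fun a b w hab haw hbw T hT => tripleVal_eq hr hsq hab haw hbw T hT)
      (fun a b hab => by
        rw [pairVal_of_adj hab, pairVal_of_adj hab.symm, arc_symm a b]
        exact Prod.ext (add_neg_cancel _) (add_zero _))
  have hφT (T) : φ (G.tripleGen T) = tripleVal G r T := dualCokerLift_tripleGen _ _ _ _ T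
  have hφp {a b : V} (h : a ≠ b) : φ (G.pairGen a b) = pairVal G r a b :=
    dualCokerLift_pairGen _ _ _ _ h
  let ψ : G.EdgeGroup × (FreeIndex G r → ℤ) →ₗ[ℤ] G.DualCoker :=
    LinearMap.coprod edgeGroupToDualCoker
      ((Pi.basisFun ℤ (FreeIndex G r)).constr ℤ
        (Sum.elim (fun T => G.tripleGen T.1) fun p => G.pairGen p.1.1 p.1.2))
  have hψ1 {a b : V} (h : G.Adj a b) : ψ (G.arc a b, 0) = G.pairGen a b := by
    rw [LinearMap.coprod_apply, map_zero, add_zero]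
    exact edgeGroupLift_arc _ _ _ h
  have hψ2 (i : FreeIndex G r) : ψ (0, Pi.single i 1) =
      Sum.elim (fun T => G.tripleGen T.1) (fun p => G.pairGen p.1.1 p.1.2) i := by
    rw [LinearMap.coprod_apply, map_zero, zero_add, ← Pi.basisFun_apply,
      Module.Basis.constr_basis]
  have hψp {a b : V} (hab : a ≠ b) : ψ (pairVal G r a b) = G.pairGen a b := by
    by_cases h1 : G.Adj a b
    · rw [pairVal_of_adj h1, hψ1 h1]
    · by_cases h2 : (∃ z, G.Adj a z ∧ G.Adj z b) → r a b
      · rw [pairVal_of_free ⟨⟨hab, h1⟩, h2⟩, hψ2]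
        rfl
      · push Not at h2
        obtain ⟨⟨z, haz, hzb⟩, h2⟩ := h2
        have hba : r b a := (hr b a hab.symm).2 h2
        rw [pairVal_of_path hr hab h1 haz hzb hba, pathDiff_eq hsq hab h1 haz hzb]
        have e : ((G.arc z a - G.arc z b, Pi.single
            (.inr ⟨(b, a), ⟨hab.symm, fun h => h1 h.symm⟩, fun _ => hba⟩) 1) :
            G.EdgeGroup × (FreeIndex G r → ℤ)) = (G.arc z a, 0) - (G.arc z b, 0) +
              (0, Pi.single (.inr ⟨(b, a), ⟨hab.symm, fun h => h1 h.symm⟩, fun _ => hba⟩) 1) := by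
          ext <;> simp
        rw [e, map_add, map_sub, hψ1 haz.symm, hψ1 hzb, hψ2]
        have := pairGen_swap haz hzb hab
        simp only [Sum.elim_inr]
        linear_combination (norm := module) -this
  have h1 : φ ∘ₗ ψ = LinearMap.id := by
    refine LinearMap.prod_ext ?_ ?_
    · refine edgeGroup_hom_ext fun a b h => ?_
      change φ (ψ (G.arc a b, 0)) = (G.arc a b, 0)
      rw [hψ1 h, hφp h.ne, pairVal_of_adj h]
    · refine LinearMap.pi_ext' fun i => LinearMap.ext_ring ?_
      change φ (ψ (0, Pi.single i 1)) = (0, Pi.single i 1)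
      rw [hψ2]
      rcases i with ⟨T, hT⟩ | ⟨⟨a, b⟩, hp⟩
      · exact (hφT T).trans (tripleVal_of_free T hT)
      · exact (hφp hp.1.1).trans (pairVal_of_free hp)
  have h2 : ψ ∘ₗ φ = LinearMap.id := by
    refine dualCoker_hom_ext (fun T => ?_) fun a b hab => ?_
    · change ψ (φ (G.tripleGen T)) = G.tripleGen T
      rw [hφT]
      by_cases hT : ∀ a ∈ T.1, ∀ b ∈ T.1, ¬G.Adj a b
      · rw [tripleVal_of_free T hT, hψ2]
        rfl
      · push Not at hT
        obtain ⟨a, ha, b, hb, hab⟩ := hT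
        obtain ⟨w, haw, hbw, hT⟩ := exists_isTriple_of_adj T.2 ha hb hab.ne
        have e1 := tripleVal_eq hr hsq hab haw hbw T hT
        have e2 := tripleGen_add hab haw hbw T hT
        have e3 := congrArg ψ e1
        rw [map_add, map_add, hψp haw, hψp hbw, map_zero] at e3
        linear_combination (norm := module) e3 - e2
    · change ψ (φ (G.pairGen a b)) = G.pairGen a b
      rw [hφp hab, hψp hab]
  exact ⟨(LinearEquiv.ofLinearMap φ ψ h1 h2).toAddEquiv⟩

end DualCokerStructure

end SimpleGraph

namespace SimpleGraph

section Chromatic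

set_option linter.unusedSectionVars false

theorem exists_eq_one_of_sum_eq_one {ι : Type*} {s : Finset ι} {d : ι → ℕ}
    (h : ∑ i ∈ s, d i = 1) : ∃ q ∈ s, d q = 1 ∧ ∀ x ∈ s, x ≠ q → d x = 0 := by
  classical
  obtain ⟨q, hq, hd⟩ := Finset.exists_ne_zero_of_sum_ne_zero (h.trans_ne one_ne_zero)
  rw [← Finset.add_sum_erase s d hq] at h
  have h0 : ∑ x ∈ s.erase q, d x = 0 := by omega
  refine ⟨q, hq, by omega, fun x hx hne => ?_⟩
  exact Finset.sum_eq_zero_iff.1 h0 x (Finset.mem_erase.2 ⟨hne, hx⟩)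

/-- The coefficient of `x ^ k` of an element of `ℤ[x]/(x ^ 3)`. -/
def TruncAlg.coeff (k : ℕ) : TruncAlg 3 →ₗ[ℤ] ℤ :=
  Polynomial.lcoeff ℤ k ∘ₗ AdjoinRoot.modByMonicHom (Polynomial.monic_X_pow 3)

theorem TruncAlg.x_pow_eq_zero {j : ℕ} (hj : 3 ≤ j) : TruncAlg.x 3 ^ j = 0 := by
  rw [TruncAlg.x, ← AdjoinRoot.mk_X, ← map_pow, AdjoinRoot.mk_eq_zero]
  exact pow_dvd_pow X hj

theorem TruncAlg.coeff_x_pow {k : ℕ} (hk : k < 3) (j : ℕ) :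
    TruncAlg.coeff k (TruncAlg.x 3 ^ j) = if j = k then 1 else 0 := by
  by_cases hj : 3 ≤ j
  · rw [TruncAlg.x_pow_eq_zero hj, map_zero, if_neg (by omega)]
  · rw [TruncAlg.coeff, LinearMap.comp_apply, TruncAlg.x, ← AdjoinRoot.mk_X, ← map_pow,
      AdjoinRoot.modByMonicHom_mk, (modByMonic_eq_self_iff (monic_X_pow 3)).2, lcoeff_apply,
      coeff_X_pow]
    · simp only [eq_comm]
    · rw [degree_X_pow, degree_X_pow]
      exact_mod_cast not_le.1 hj

variable {V : Type u} [Fintype V] {G : SimpleGraph V}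

/-- The tensor product of the monomials with given exponents. -/
def stateMonomial (s : Finset G.edgeSet) (w : G.StateComp s → ℕ) : G.StateModule 3 s :=
  ⨂ₜ[ℤ] c, TruncAlg.x 3 ^ w c

theorem stateMonomial_eq_zero {s : Finset G.edgeSet} {w : G.StateComp s → ℕ}
    {c : G.StateComp s} (h : 3 ≤ w c) : stateMonomial s w = 0 :=
  MultilinearMap.map_coord_zero _ c (TruncAlg.x_pow_eq_zero h)

/-- The coefficient of a monomial. -/
def stateCoeff (s : Finset G.edgeSet) (w : G.StateComp s → ℕ) : G.StateModule 3 s →ₗ[ℤ] ℤ :=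
  PiTensorProduct.lift
    ((MultilinearMap.mkPiAlgebra ℤ (G.StateComp s) ℤ).compLinearMap fun c => TruncAlg.coeff (w c))

open Classical in
theorem stateCoeff_stateMonomial {s : Finset G.edgeSet} {w : G.StateComp s → ℕ}
    (hw : ∀ c, w c < 3) (w' : G.StateComp s → ℕ) :
    stateCoeff s w (stateMonomial s w') = if w' = w then 1 else 0 := by
  rw [stateCoeff, stateMonomial, PiTensorProduct.lift.tprod, MultilinearMap.compLinearMap_apply,
    MultilinearMap.mkPiAlgebra_apply]
  simp only [TruncAlg.coeff_x_pow (hw _)]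
  rw [Finset.prod_ite_zero]
  simp [funext_iff]

open Classical in
/-- The exponents after merging components. -/
def mergeExp {s t : Finset G.edgeSet} (h : s ⊆ t) (w : G.StateComp s → ℕ) (c' : G.StateComp t) :
    ℕ := ∑ c with compMap h c = c', w c

theorem mergeMap_stateMonomial {s t : Finset G.edgeSet} (h : s ⊆ t) (w : G.StateComp s → ℕ) :
    mergeMap 3 h (stateMonomial s w) = stateMonomial t (mergeExp h w) := by
  classical
  rw [mergeMap, stateMonomial, PiTensorProduct.lift.tprod, stateMonomial]
  change (⨂ₜ[ℤ] c', ∏ c with compMap h c = c', TruncAlg.x 3 ^ w c) = _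
  congr 1
  funext c'
  rw [Finset.prod_pow_eq_pow_sum, mergeExp]

theorem sum_mergeExp {s t : Finset G.edgeSet} (h : s ⊆ t) (w : G.StateComp s → ℕ) :
    ∑ c', mergeExp h w c' = ∑ c, w c := by
  classical
  simp only [mergeExp]
  exact Finset.sum_fiberwise Finset.univ (compMap h) w

theorem stateDegree_eq (s : Finset G.edgeSet) (j : ℤ) : G.stateDegree 3 s j =
    Submodule.span ℤ {z | ∃ w : G.StateComp s → ℕ, ((∑ c, w c : ℕ) : ℤ) = j ∧
      z = stateMonomial s w} := rfl

theorem stateMonomial_mem {s : Finset G.edgeSet} {w : G.StateComp s → ℕ} {j : ℤ}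
    (h : ((∑ c, w c : ℕ) : ℤ) = j) : stateMonomial s w ∈ G.stateDegree 3 s j :=
  Submodule.subset_span ⟨w, h, rfl⟩

theorem mergeMap_mem {s t : Finset G.edgeSet} (h : s ⊆ t) {j : ℤ} {z : G.StateModule 3 s}
    (hz : z ∈ G.stateDegree 3 s j) : mergeMap 3 h z ∈ G.stateDegree 3 t j := by
  rw [stateDegree_eq] at hz
  induction hz using Submodule.span_induction with
  | mem z hz =>
    obtain ⟨w, hw, rfl⟩ := hz
    rw [mergeMap_stateMonomial]
    exact stateMonomial_mem (by rw [sum_mergeExp, hw])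
  | zero => rw [map_zero]; exact zero_mem _
  | add x y _ _ hx hy => rw [map_add]; exact add_mem hx hy
  | smul r x _ hx => rw [map_smul]; exact Submodule.smul_mem _ _ hx

theorem stateMk_empty_bijective : Function.Bijective (G.stateMk ∅) := by
  constructor
  · intro x y h
    have hr := ConnectedComponent.exact h
    rw [reachable_iff_reflTransGen] at hr
    induction hr with
    | refl => rfl
    | tail _ hyz => simp [stateGraph] at hyz
  · intro c
    induction c using ConnectedComponent.ind with
    | h x => exact ⟨x, rfl⟩

theorem card_stateComp_singleton (e : G.edgeSet) :
    Fintype.card (G.StateComp {e}) + 1 = Fintype.card V := by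
  classical
  obtain ⟨e, he⟩ := e
  induction e with
  | h a b =>
    have hab : a ≠ b := G.ne_of_adj he
    have hbij : Function.Bijective fun x : {x // x ≠ b} => G.stateMk {⟨s(a, b), he⟩} x := by
      constructor
      · rintro ⟨x, hx⟩ ⟨y, hy⟩ h
        rcases stateMk_singleton_eq.1 h with h | ⟨h1, h2⟩
        · exact Subtype.ext h
        · simp only [Sym2.mem_iff] at h1 h2
          exact Subtype.ext ((h1.resolve_right hx).trans (h2.resolve_right hy).symm)
      · intro c
        induction c using ConnectedComponent.ind with
        | h x =>
          by_cases hx : x = b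
          · exact ⟨⟨a, hab⟩, stateMk_singleton_eq.2 (.inr ⟨by simp, by simp [hx]⟩)⟩
          · exact ⟨⟨x, hx⟩, rfl⟩
    rw [← Fintype.card_of_bijective hbij]
    have h1 := Fintype.card_subtype_compl (fun x : V => x = b)
    rw [Fintype.card_subtype_eq] at h1
    have h2 : 0 < Fintype.card V := Fintype.card_pos_iff.2 ⟨b⟩
    change Fintype.card {x // ¬x = b} + 1 = _
    omega

theorem card_stateComp_lt {e e' : G.edgeSet} {t : Finset G.edgeSet} (h : {e'} ⊆ t) (he : e ∈ t)
    (hne : e ≠ e') : Fintype.card (G.StateComp t) < Fintype.card (G.StateComp {e'}) := by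
  obtain ⟨e, hE⟩ := e
  induction e with
  | h a b =>
    have hab : a ≠ b := G.ne_of_adj hE
    refine Fintype.card_lt_of_surjective_not_injective (compMap h) ?_ ?_
    · intro c
      induction c using ConnectedComponent.ind with
      | h x => exact ⟨G.stateMk _ x, rfl⟩
    · intro hinj
      have h1 : compMap h (G.stateMk {e'} a) = compMap h (G.stateMk {e'} b) := by
        refine ConnectedComponent.sound (Adj.reachable ?_)
        change (G.stateGraph t).Adj a b
        rw [stateGraph, fromEdgeSet_adj]
        exact ⟨⟨_, he, rfl⟩, hab⟩
      rcases stateMk_singleton_eq.1 (hinj h1) with h2 | h2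
      · exact hab h2
      · exact hne (Subtype.ext ((Sym2.mem_and_mem_iff hab).1 h2).symm)

open Classical in
/-- The exponents that are one at a given component and two elsewhere. -/
def topExp {s : Finset G.edgeSet} (c c' : G.StateComp s) : ℕ := if c' = c then 1 else 2

theorem topExp_lt {s : Finset G.edgeSet} (c c' : G.StateComp s) : topExp c c' < 3 := by
  rw [topExp]
  split_ifs <;> omega

theorem topExp_injective {s : Finset G.edgeSet} {c c' : G.StateComp s}
    (h : topExp c = topExp c') : c = c' := by
  have := congrFun h c
  simp only [topExp, if_true] at this
  by_contra hne
  simp [hne] at this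

theorem sum_topExp {s : Finset G.edgeSet} (c : G.StateComp s) :
    ∑ c', topExp c c' + 1 = 2 * Fintype.card (G.StateComp s) := by
  classical
  have h : ∀ c', topExp c c' + (if c' = c then 1 else 0) = 2 := fun c' => by
    rw [topExp]
    split_ifs <;> rfl
  have h1 := Finset.sum_congr (rfl : (Finset.univ : Finset (G.StateComp s)) = _)
    fun c' _ => h c'
  rw [Finset.sum_add_distrib, Finset.sum_ite_eq' Finset.univ c, if_pos (Finset.mem_univ _)] at h1
  rw [h1, Finset.sum_const, Finset.card_univ, smul_eq_mul, mul_comm]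

theorem sum_topExp_singleton {e : G.edgeSet} (c : G.StateComp {e}) :
    ((∑ c', topExp c c' : ℕ) : ℤ) = 2 * (Nat.card V : ℤ) - 3 := by
  have h1 := sum_topExp c
  have h2 := card_stateComp_singleton e
  rw [Nat.card_eq_fintype_card]
  omega

theorem exists_topExp {s : Finset G.edgeSet} {w : G.StateComp s → ℕ} (hw : ∀ c, w c < 3)
    (h : ∑ c, w c + 1 = 2 * Fintype.card (G.StateComp s)) : ∃ c, w = topExp c := by
  have h1 : ∑ c, (2 - w c) = 1 := by
    have h2 : ∑ c, (2 - w c) + ∑ c, w c = 2 * Fintype.card (G.StateComp s) := by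
      rw [← Finset.sum_add_distrib]
      have : ∀ c, 2 - w c + w c = 2 := fun c => by have := hw c; omega
      simp only [this, Finset.sum_const, Finset.card_univ, smul_eq_mul]
      rw [mul_comm]
    omega
  obtain ⟨q, -, hq, h0⟩ := exists_eq_one_of_sum_eq_one h1
  refine ⟨q, funext fun c => ?_⟩
  have h3 := hw c
  have h4 := h0 c (Finset.mem_univ _)
  rw [topExp]
  split_ifs with h
  · subst h; omega
  · have := h4 h
    omega

theorem eq_sum_stateCoeff {e : G.edgeSet} {z : G.StateModule 3 {e}}
    (hz : z ∈ G.stateDegree 3 {e} (2 * (Nat.card V : ℤ) - 3)) :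
    z = ∑ c, stateCoeff {e} (topExp c) z • stateMonomial {e} (topExp c) := by
  classical
  rw [stateDegree_eq] at hz
  induction hz using Submodule.span_induction with
  | mem z hz =>
    obtain ⟨w, hw, rfl⟩ := hz
    simp only [stateCoeff_stateMonomial (topExp_lt _)]
    by_cases h3 : ∃ c, 3 ≤ w c
    · obtain ⟨c, hc⟩ := h3
      rw [stateMonomial_eq_zero hc, Finset.sum_eq_zero]
      intro c' _
      rw [if_neg, zero_smul]
      rintro rfl
      exact absurd (topExp_lt c' c) (not_lt.2 hc)
    · push Not at h3
      obtain ⟨c, rfl⟩ := exists_topExp h3 (by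
        have := card_stateComp_singleton e
        rw [Nat.card_eq_fintype_card] at hw
        omega)
      rw [Finset.sum_eq_single c]
      · rw [if_pos rfl, one_smul]
      · intro c' _ hc'
        rw [if_neg fun h => hc' (topExp_injective h).symm, zero_smul]
      · simp
  | zero => simp
  | add x y _ _ hx hy =>
    simp only [map_add, add_smul, Finset.sum_add_distrib]
    rw [← hx, ← hy]
  | smul r x _ hx =>
    simp only [map_smul, smul_eq_mul, mul_smul, ← Finset.smul_sum]
    rw [← hx]

theorem mergeMap_eq_zero {e e' : G.edgeSet} {t : Finset G.edgeSet} (h : {e'} ⊆ t) (he : e ∈ t)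
    (hne : e ≠ e') {z : G.StateModule 3 {e'}}
    (hz : z ∈ G.stateDegree 3 {e'} (2 * (Nat.card V : ℤ) - 3)) : mergeMap 3 h z = 0 := by
  rw [stateDegree_eq] at hz
  induction hz using Submodule.span_induction with
  | mem z hz =>
    obtain ⟨w, hw, rfl⟩ := hz
    rw [mergeMap_stateMonomial]
    by_contra h0
    have h3 : ∀ c, mergeExp h w c ≤ 2 := fun c => by
      by_contra hc
      exact h0 (stateMonomial_eq_zero (c := c) (by omega))
    have h4 := Finset.sum_le_sum fun c (_ : c ∈ Finset.univ) => h3 c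
    rw [sum_mergeExp, Finset.sum_const, Finset.card_univ, smul_eq_mul] at h4
    have h5 := card_stateComp_lt h he hne
    have h6 := card_stateComp_singleton e'
    rw [Nat.card_eq_fintype_card] at hw
    omega
  | zero => rw [map_zero]
  | add x y _ _ hx hy => rw [map_add, hx, hy, add_zero]
  | smul r x _ hx => rw [map_smul, hx, smul_zero]

variable (num : G.edgeSet ≃ Fin (Nat.card G.edgeSet))

theorem coboundary_eq_zero {f : G.Cochain 3}
    (hf : f ∈ G.cochainDegree 3 1 (2 * (Nat.card V : ℤ) - 3)) : G.coboundary num 3 f = 0 := by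
  classical
  funext t
  rw [coboundary, LinearMap.pi_apply, LinearMap.sum_apply]
  refine Finset.sum_eq_zero fun e he => ?_
  rw [LinearMap.smul_apply, LinearMap.comp_apply, LinearMap.proj_apply]
  obtain ⟨h1, h2⟩ := hf (t.erase e)
  by_cases hc : (t.erase e).card = 1
  · obtain ⟨e', he'⟩ := Finset.card_eq_one.1 hc
    have hne : e ≠ e' := by
      rintro rfl
      have : e ∈ t.erase e := by rw [he']; simp
      simp at this
    have key (s : Finset G.edgeSet) (hs : s = {e'}) (h : s ⊆ t) (z : G.StateModule 3 s)
        (hz : z ∈ G.stateDegree 3 s (2 * (Nat.card V : ℤ) - 3)) : mergeMap 3 h z = 0 := by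
      subst hs
      exact mergeMap_eq_zero h he hne hz
    rw [key _ he' _ _ h1, smul_zero]
  · rw [h2 hc, map_zero, smul_zero]

theorem cocycles_eq : G.cocycles num 3 1 (2 * (Nat.card V : ℤ) - 3) =
    G.cochainDegree 3 1 (2 * (Nat.card V : ℤ) - 3) :=
  inf_eq_left.2 fun _ hf => coboundary_eq_zero num hf

theorem coboundary_singleton (f : G.Cochain 3) (e : G.edgeSet) :
    G.coboundary num 3 f {e} = mergeMap 3 (Finset.empty_subset _) (f ∅) := by
  classical
  rw [coboundary, LinearMap.pi_apply, LinearMap.sum_apply, Finset.sum_singleton,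
    LinearMap.smul_apply, LinearMap.comp_apply, LinearMap.proj_apply]
  have key (s : Finset G.edgeSet) (hs : s = ∅) (h : s ⊆ {e}) :
      (-1 : ℤ) ^ (s.filter fun f => num f < num e).card • mergeMap 3 h (f s) =
        mergeMap 3 (Finset.empty_subset _) (f ∅) := by
    subst hs
    simp
  exact key _ (by simp) _

theorem coboundary_mem {f : G.Cochain 3} {j : ℤ} (hf : f ∈ G.cochainDegree 3 0 j) :
    G.coboundary num 3 f ∈ G.cochainDegree 3 1 j := by
  classical
  intro t
  have h0 : t.card ≠ 1 → G.coboundary num 3 f t = 0 := by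
    intro ht
    rw [coboundary, LinearMap.pi_apply, LinearMap.sum_apply]
    refine Finset.sum_eq_zero fun e he => ?_
    rw [LinearMap.smul_apply, LinearMap.comp_apply, LinearMap.proj_apply, (hf _).2, map_zero,
      smul_zero]
    rw [Finset.card_erase_of_mem he]
    have := Finset.card_pos.2 ⟨e, he⟩
    omega
  refine ⟨?_, h0⟩
  by_cases ht : t.card = 1
  · obtain ⟨e, rfl⟩ := Finset.card_eq_one.1 ht
    rw [coboundary_singleton]
    exact mergeMap_mem _ (hf _).1
  · rw [h0 ht]
    exact zero_mem _

variable (G) in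
/-- The top coefficients of a cochain on the states with one edge. -/
def topCoeff : G.Cochain 3 →ₗ[ℤ] (G.StateRow → ℤ) :=
  LinearMap.pi fun r => stateCoeff {r.1} (topExp r.2) ∘ₗ LinearMap.proj {r.1}

variable (G) in
/-- The top coefficients of the coboundary of a cochain supported on the empty state. -/
def mergeCoeff : G.StateModule 3 ∅ →ₗ[ℤ] (G.StateRow → ℤ) :=
  LinearMap.pi fun r => stateCoeff {r.1} (topExp r.2) ∘ₗ mergeMap 3 (Finset.empty_subset _)

theorem topCoeff_coboundary (f : G.Cochain 3) :
    G.topCoeff (G.coboundary num 3 f) = G.mergeCoeff (f ∅) := by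
  funext r
  simp only [topCoeff, mergeCoeff, LinearMap.pi_apply, LinearMap.comp_apply, LinearMap.proj_apply]
  rw [coboundary_singleton]

open Classical in
theorem single_mem_cochainDegree {s : Finset G.edgeSet} {z : G.StateModule 3 s} {j : ℤ}
    (hz : z ∈ G.stateDegree 3 s j) :
    (Pi.single s z : G.Cochain 3) ∈ G.cochainDegree 3 s.card j := by
  intro t
  by_cases h : t = s
  · subst h
    rw [Pi.single_eq_same]
    exact ⟨hz, fun h => absurd rfl h⟩
  · rw [Pi.single_eq_of_ne h]
    exact ⟨zero_mem _, fun _ => rfl⟩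

open Classical in
theorem topCoeff_single (r : G.StateRow) :
    G.topCoeff (Pi.single {r.1} (stateMonomial {r.1} (topExp r.2))) = Pi.single r 1 := by
  funext ⟨e', c'⟩
  obtain ⟨e, c⟩ := r
  simp only [topCoeff, LinearMap.pi_apply, LinearMap.comp_apply, LinearMap.proj_apply]
  by_cases h : e' = e
  · subst h
    rw [Pi.single_eq_same, stateCoeff_stateMonomial (topExp_lt _), Pi.single_apply]
    congr 1
    refine propext ⟨fun h => ?_, fun h => ?_⟩
    · rw [topExp_injective h]
    · rw [eq_of_heq (Sigma.mk.inj_iff.1 h).2]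
  · rw [Pi.single_eq_of_ne (by simpa using h), map_zero, Pi.single_eq_of_ne]
    intro h'
    exact h (Sigma.mk.inj_iff.1 h').1

theorem topCoeff_injOn {f : G.Cochain 3}
    (hf : f ∈ G.cochainDegree 3 1 (2 * (Nat.card V : ℤ) - 3)) (h : G.topCoeff f = 0) : f = 0 := by
  funext s
  by_cases hs : s.card = 1
  · obtain ⟨e, rfl⟩ := Finset.card_eq_one.1 hs
    rw [eq_sum_stateCoeff (hf {e}).1, Pi.zero_apply]
    refine Finset.sum_eq_zero fun c _ => ?_
    have : stateCoeff {e} (topExp c) (f {e}) = 0 := congrFun h ⟨e, c⟩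
    rw [this, zero_smul]
  · exact (hf s).2 hs

theorem topCoeff_surjOn (g : G.StateRow → ℤ) :
    ∃ f ∈ G.cochainDegree 3 1 (2 * (Nat.card V : ℤ) - 3), G.topCoeff f = g := by
  classical
  have := Fintype.ofFinite G.edgeSet
  refine ⟨∑ r : G.StateRow, g r • Pi.single {r.1} (stateMonomial {r.1} (topExp r.2)), ?_, ?_⟩
  · refine Submodule.sum_mem _ fun r _ => Submodule.smul_mem _ _ ?_
    exact single_mem_cochainDegree (s := {r.1}) (stateMonomial_mem (sum_topExp_singleton r.2))
  · rw [map_sum]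
    simp only [map_smul, topCoeff_single]
    funext r
    simp [Finset.sum_apply, Pi.single_apply]

/-- The top coefficients identify the cocycles of degree `2v - 3` with the functions on the
states with one edge and a component. -/
def cocyclesEquiv : G.cocycles num 3 1 (2 * (Nat.card V : ℤ) - 3) ≃ₗ[ℤ] (G.StateRow → ℤ) :=
  LinearEquiv.ofBijective (G.topCoeff.domRestrict _) (by
    rw [cocycles_eq]
    constructor
    · rw [injective_iff_map_eq_zero]
      exact fun f hf => Subtype.ext (topCoeff_injOn f.2 hf)
    · intro g
      obtain ⟨f, hf, rfl⟩ := topCoeff_surjOn g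
      exact ⟨⟨f, hf⟩, rfl⟩)

/-- The exponents of the monomial of a triple or a pair of vertices. -/
def colExp [DecidableEq V] : StateCol V → V → ℕ
  | .inl T, x => if x ∈ T.1 then 1 else 2
  | .inr p, x => if x = p.1.1 then 0 else if x = p.1.2 then 1 else 2

theorem sum_colExp [DecidableEq V] (c : StateCol V) :
    ∑ x, colExp c x + 3 = 2 * Fintype.card V := by
  rcases c with T | ⟨⟨p, q⟩, hpq⟩
  · have h (x : V) : colExp (.inl T) x + (if x ∈ T.1 then 1 else 0) = 2 := by
      simp only [colExp]
      split_ifs <;> rfl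
    have h1 := Finset.sum_congr (rfl : (Finset.univ : Finset V) = _) fun x _ => h x
    rw [Finset.sum_add_distrib, Finset.sum_ite_mem] at h1
    simpa [T.2, mul_comm] using h1
  · have h (x : V) : colExp (.inr ⟨(p, q), hpq⟩) x +
        ((if x = p then 2 else 0) + (if x = q then 1 else 0)) = 2 := by
      have : p ≠ q := hpq
      simp only [colExp]
      split_ifs <;> grind
    have h1 := Finset.sum_congr (rfl : (Finset.univ : Finset V) = _) fun x _ => h x
    rw [Finset.sum_add_distrib, Finset.sum_add_distrib, Finset.sum_ite_eq', Finset.sum_ite_eq'] at h1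
    simpa [mul_comm] using h1

theorem exists_colExp [DecidableEq V] {u : V → ℕ} (hu : ∀ x, u x < 3)
    (h : ∑ x, u x + 3 = 2 * Fintype.card V) : ∃ c, u = colExp c := by
  have h1 : ∑ x, (2 - u x) = 3 := by
    have h2 : ∑ x, (2 - u x) + ∑ x, u x = 2 * Fintype.card V := by
      rw [← Finset.sum_add_distrib]
      have : ∀ x, 2 - u x + u x = 2 := fun x => by have := hu x; omega
      simp only [this, Finset.sum_const, Finset.card_univ, smul_eq_mul]
      rw [mul_comm]
    omega
  by_cases hp : ∃ p, u p = 0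
  · obtain ⟨p, hp⟩ := hp
    rw [← Finset.add_sum_erase _ _ (Finset.mem_univ p), hp] at h1
    obtain ⟨q, hq, hq1, h0⟩ := exists_eq_one_of_sum_eq_one (s := Finset.univ.erase p)
      (d := fun x => 2 - u x) (by omega)
    have hqp : q ≠ p := (Finset.mem_erase.1 hq).1
    refine ⟨.inr ⟨(p, q), hqp.symm⟩, funext fun x => ?_⟩
    have h3 := hu x
    have h4 := h0 x
    simp only [Finset.mem_erase, Finset.mem_univ, and_true] at h4
    simp only [colExp]
    split_ifs with h5 h6
    · rw [h5, hp]
    · subst h6; omega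
    · have := h4 h5 h6
      omega
  · push Not at hp
    have h2 (x : V) : 2 - u x = if u x = 1 then 1 else 0 := by
      have := hu x
      have := hp x
      split_ifs <;> omega
    refine ⟨.inl ⟨Finset.univ.filter fun x => u x = 1, ?_⟩, funext fun x => ?_⟩
    · rw [Finset.card_filter, ← h1]
      exact Finset.sum_congr rfl fun x _ => (h2 x).symm
    · have := hu x
      have := hp x
      simp only [colExp, Finset.mem_filter, Finset.mem_univ, true_and]
      split_ifs <;> omega

variable (G) in
/-- The components of the empty state are the vertices. -/
def vertexEquiv : V ≃ G.StateComp ∅ := Equiv.ofBijective _ stateMk_empty_bijective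

open Classical in
theorem mergeExp_empty (s : Finset G.edgeSet) (u : V → ℕ) (c : G.StateComp s) :
    mergeExp (Finset.empty_subset s) (u ∘ G.vertexEquiv.symm) c =
      ∑ x with G.stateMk s x = c, u x := by
  rw [mergeExp]
  symm
  refine Finset.sum_equiv G.vertexEquiv (fun x => ?_) (fun x _ => ?_)
  · rw [Finset.mem_filter_univ, Finset.mem_filter_univ]
    exact Iff.rfl
  · rw [Function.comp_apply, Equiv.symm_apply_apply]

theorem mergeExp_vertex [DecidableEq V] {a b : V} (hab : G.Adj a b) (u : V → ℕ)
    (c : G.StateComp {⟨s(a, b), hab⟩}) :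
    mergeExp (Finset.empty_subset {⟨s(a, b), hab⟩}) (u ∘ G.vertexEquiv.symm) = topExp c ↔
      (∀ x, x ≠ a → x ≠ b → u x = topExp c (G.stateMk _ x)) ∧
        u a + u b = topExp c (G.stateMk _ a) := by
  classical
  have h0 := mergeExp_empty {⟨s(a, b), hab⟩} u
  have h1 (x : V) (hxa : x ≠ a) (hxb : x ≠ b) :
      (Finset.univ.filter fun y => G.stateMk {⟨s(a, b), hab⟩} y = G.stateMk _ x) = {x} := by
    ext y
    simp only [Finset.mem_filter, Finset.mem_univ, true_and, stateMk_singleton_eq, Sym2.mem_iff,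
      Finset.mem_singleton]
    tauto
  have h2 : (Finset.univ.filter fun y => G.stateMk {⟨s(a, b), hab⟩} y = G.stateMk _ a) =
      {a, b} := by
    ext y
    simp only [Finset.mem_filter, Finset.mem_univ, true_and, stateMk_singleton_eq, Sym2.mem_iff,
      Finset.mem_singleton, Finset.mem_insert]
    tauto
  constructor
  · intro h
    refine ⟨fun x hxa hxb => ?_, ?_⟩
    · rw [← h, h0, h1 x hxa hxb, Finset.sum_singleton]
    · rw [← h, h0, h2, Finset.sum_pair hab.ne]
  · rintro ⟨h3, h4⟩
    funext c'
    induction c' using ConnectedComponent.ind with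
    | h x =>
      change mergeExp _ _ (G.stateMk _ x) = topExp c (G.stateMk _ x)
      by_cases hx : x = a ∨ x = b
      · have : G.stateMk {⟨s(a, b), hab⟩} x = G.stateMk _ a :=
          stateMk_singleton_eq.2 (.inr ⟨by simpa using hx, by simp⟩)
        rw [this, h0, h2, Finset.sum_pair hab.ne, h4]
      · push Not at hx
        rw [h0, h1 x hx.1 hx.2, Finset.sum_singleton, h3 x hx.1 hx.2]

theorem stateMatrix_apply [DecidableEq V] (r : G.StateRow) (c : StateCol V) :
    G.stateMatrix r c = if mergeExp (Finset.empty_subset {r.1}) (colExp c ∘ G.vertexEquiv.symm) =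
      topExp r.2 then 1 else 0 := by
  classical
  rcases stateRow_cases r with ⟨a, b, w, hab, haw, hbw, rfl⟩ | ⟨a, b, hab, rfl⟩
  · have h0 : a ≠ b := hab.ne
    obtain ⟨T, hT⟩ := exists_isTriple h0 haw hbw
    rw [stateMatrix_row hab haw hbw T hT]
    refine Eq.trans ?_ (if_congr (mergeExp_vertex hab _ _).symm rfl rfl)
    have ht (x : V) : topExp (G.stateMk {⟨s(a, b), hab⟩} w) (G.stateMk _ x) =
        if x = w then 1 else 2 := by
      rw [topExp]
      congr 1
      rw [stateMk_singleton_eq, Sym2.mem_iff, Sym2.mem_iff]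
      refine propext ⟨fun h => h.resolve_right fun h => ?_, .inl⟩
      exact h.2.elim haw.symm hbw.symm
    simp only [ht, haw, if_false]
    rcases c with T' | ⟨⟨p, q⟩, hpq⟩
    · simp only [Pi.add_apply, Pi.single_apply, Sum.inl.injEq, reduceCtorEq, if_false, add_zero]
      congr 1
      refine propext ⟨?_, ?_⟩
      · rintro rfl
        refine ⟨fun x hxa hxb => ?_, ?_⟩
        · simp only [colExp, hT x, hxa, hxb, false_or]
        · simp [colExp, hT a, hT b]
      · rintro ⟨h1, h2⟩
        apply Subtype.ext
        ext x
        rw [hT x]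
        have h3 : a ∈ T'.1 ∧ b ∈ T'.1 := by
          simp only [colExp] at h2
          split_ifs at h2 <;> simp_all
        by_cases hxa : x = a
        · simp [hxa, h3.1]
        · by_cases hxb : x = b
          · simp [hxb, h3.2]
          · have h4 := h1 x hxa hxb
            simp only [colExp] at h4
            simp only [hxa, hxb, false_or]
            split_ifs at h4 <;> simp_all
    · have hpq' : p ≠ q := hpq
      simp only [Pi.add_apply, Pi.single_apply, reduceCtorEq, if_false, Sum.inr.injEq,
        Subtype.mk.injEq, Prod.mk.injEq, zero_add, colExp]
      by_cases h1 : (p = a ∨ p = b) ∧ q = w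
      · obtain ⟨h1, rfl⟩ := h1
        refine Eq.trans ?_ (if_pos ?_).symm
        · rcases h1 with rfl | rfl <;> simp [h0, h0.symm]
        · refine ⟨fun x hxa hxb => ?_, ?_⟩ <;> rcases h1 with rfl | rfl <;>
            simp_all [Ne.symm]
      · rw [if_neg, if_neg, if_neg, add_zero]
        · rintro ⟨h2, h3⟩
          have hp := h2 p
          have hq := h2 q
          have hw := h2 w haw.symm hbw.symm
          grind
        · rintro ⟨rfl, rfl⟩
          exact h1 ⟨.inr rfl, rfl⟩
        · rintro ⟨rfl, rfl⟩
          exact h1 ⟨.inl rfl, rfl⟩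
  · have h0 : a ≠ b := hab.ne
    rw [stateMatrix_row_self]
    refine Eq.trans ?_ (if_congr (mergeExp_vertex hab _ _).symm rfl rfl)
    have ht (x : V) : topExp (G.stateMk {⟨s(a, b), hab⟩} a) (G.stateMk _ x) =
        if x = a ∨ x = b then 1 else 2 := by
      rw [topExp]
      congr 1
      rw [stateMk_singleton_eq, Sym2.mem_iff, Sym2.mem_iff]
      exact propext ⟨fun h => h.elim .inl fun h => h.1, fun h => .inr ⟨h, .inl rfl⟩⟩
    simp only [ht, true_or, if_true]
    rcases c with T' | ⟨⟨p, q⟩, hpq⟩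
    · simp only [Pi.add_apply, Pi.single_apply, reduceCtorEq, if_false, add_zero]
      rw [if_neg]
      rintro ⟨-, h⟩
      simp only [colExp] at h
      split_ifs at h <;> omega
    · have hpq' : p ≠ q := hpq
      simp only [Pi.add_apply, Pi.single_apply, Sum.inr.injEq, Subtype.mk.injEq, Prod.mk.injEq,
        colExp]
      by_cases h1 : (p = a ∧ q = b) ∨ (p = b ∧ q = a)
      · refine Eq.trans ?_ (if_pos ?_).symm
        · rcases h1 with ⟨rfl, rfl⟩ | ⟨rfl, rfl⟩ <;> simp [h0, h0.symm]
        · refine ⟨fun x hxa hxb => ?_, ?_⟩ <;> rcases h1 with ⟨rfl, rfl⟩ | ⟨rfl, rfl⟩ <;>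
            simp_all [Ne.symm]
      · rw [if_neg (fun h => h1 (.inl h)), if_neg (fun h => h1 (.inr h)), if_neg, add_zero]
        rintro ⟨h2, h3⟩
        have hp := h2 p
        have hq := h2 q
        grind

theorem mergeCoeff_stateMonomial [DecidableEq V] (c : StateCol V) :
    G.mergeCoeff (stateMonomial ∅ (colExp c ∘ G.vertexEquiv.symm)) = G.stateMatrix.transpose c := by
  classical
  funext r
  simp only [mergeCoeff, LinearMap.pi_apply, LinearMap.comp_apply]
  rw [mergeMap_stateMonomial, stateCoeff_stateMonomial (topExp_lt _), Matrix.transpose_apply,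
    stateMatrix_apply]

theorem sum_comp_vertexEquiv (w : G.StateComp ∅ → ℕ) :
    ∑ x, w (G.vertexEquiv x) = ∑ c, w c := G.vertexEquiv.sum_comp w

theorem mergeCoeff_mem {z : G.StateModule 3 ∅}
    (hz : z ∈ G.stateDegree 3 ∅ (2 * (Nat.card V : ℤ) - 3)) :
    G.mergeCoeff z ∈ Submodule.span ℤ (Set.range G.stateMatrix.transpose) := by
  classical
  rw [stateDegree_eq] at hz
  induction hz using Submodule.span_induction with
  | mem z hz =>
    obtain ⟨w, hw, rfl⟩ := hz
    by_cases h3 : ∃ c, 3 ≤ w c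
    · obtain ⟨c, hc⟩ := h3
      rw [stateMonomial_eq_zero hc, map_zero]
      exact zero_mem _
    · push Not at h3
      obtain ⟨c, hc⟩ := exists_colExp (u := w ∘ G.vertexEquiv) (fun x => h3 _) (by
        have := sum_comp_vertexEquiv w
        rw [Nat.card_eq_fintype_card] at hw
        simp only [Function.comp_apply]
        omega)
      have hw' : w = colExp c ∘ G.vertexEquiv.symm := by
        rw [← hc, Function.comp_assoc, Equiv.self_comp_symm, Function.comp_id]
      rw [hw', mergeCoeff_stateMonomial]
      exact Submodule.subset_span ⟨c, rfl⟩
  | zero => rw [map_zero]; exact zero_mem _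
  | add x y _ _ hx hy => rw [map_add]; exact add_mem hx hy
  | smul r x _ hx => rw [map_smul]; exact Submodule.smul_mem _ _ hx

theorem coboundaries_eq (j : ℤ) : G.coboundaries num 3 1 j =
    (G.cochainDegree 3 0 j).map (G.coboundary num 3) := by
  simp [coboundaries]

theorem map_coboundaries :
    ((G.coboundaries num 3 1 (2 * (Nat.card V : ℤ) - 3)).comap
      (G.cocycles num 3 1 (2 * (Nat.card V : ℤ) - 3)).subtype).map
        (cocyclesEquiv num : _ →ₗ[ℤ] (G.StateRow → ℤ)) =
      Submodule.span ℤ (Set.range G.stateMatrix.transpose) := by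
  classical
  rw [coboundaries_eq]
  apply le_antisymm
  · rintro _ ⟨⟨z, hz⟩, ⟨f, hf, hfz⟩, rfl⟩
    have : G.topCoeff z = G.mergeCoeff (f ∅) := by
      rw [← topCoeff_coboundary num f, hfz]
      rfl
    change G.topCoeff z ∈ _
    rw [this]
    exact mergeCoeff_mem (hf _).1
  · rw [Submodule.span_le]
    rintro _ ⟨c, rfl⟩
    have hdeg : ((∑ x, (colExp c ∘ G.vertexEquiv.symm) x : ℕ) : ℤ) =
        2 * (Nat.card V : ℤ) - 3 := by
      have h1 := G.vertexEquiv.symm.sum_comp (colExp c)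
      have h2 := sum_colExp c
      rw [Nat.card_eq_fintype_card]
      simp only [Function.comp_apply]
      omega
    have hf : (Pi.single ∅ (stateMonomial ∅ (colExp c ∘ G.vertexEquiv.symm)) : G.Cochain 3) ∈
        G.cochainDegree 3 0 (2 * (Nat.card V : ℤ) - 3) :=
      single_mem_cochainDegree (s := ∅) (stateMonomial_mem hdeg)
    refine ⟨⟨_, (cocycles_eq num).ge (coboundary_mem num hf)⟩, ⟨_, hf, rfl⟩, ?_⟩
    refine (topCoeff_coboundary num _).trans ?_
    rw [Pi.single_eq_same, mergeCoeff_stateMonomial]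

/-- The first chromatic cohomology in degree `2v - 3` is the cokernel of `stateMatrix`. -/
def chromaticCohomologyEquiv : G.chromaticCohomology num 3 1 (2 * (Nat.card V : ℤ) - 3) ≃+
    (G.StateRow → ℤ) ⧸ Submodule.span ℤ (Set.range G.stateMatrix.transpose) :=
  (Submodule.Quotient.equiv _ _ (cocyclesEquiv num) (map_coboundaries num)).toAddEquiv

end Chromatic

end SimpleGraph

namespace SimpleGraph

section Counting

set_option linter.unusedSectionVars false

variable {V : Type u} [Fintype V] (G : SimpleGraph V)

open Classical in
/-- The edges spanned by a set of vertices. -/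
def spannedEdges (T : Finset V) : Finset (Sym2 V) := G.edgeFinset.filter fun e => ∀ x ∈ e, x ∈ T

theorem ncard_spannedEdges (T : Finset V) :
    Set.ncard {e ∈ G.edgeSet | ∀ x ∈ e, x ∈ T} = (G.spannedEdges T).card := by
  classical
  rw [← Set.ncard_coe_finset]
  congr 1
  ext e
  simp [spannedEdges]

theorem numTriples_eq (k : ℕ) : G.numTriples k =
    ((Finset.univ.powersetCard 3).filter fun T => (G.spannedEdges T).card = k).card := by
  classical
  rw [numTriples, ← Set.ncard_coe_finset]
  congr 1
  ext T
  simp [ncard_spannedEdges, Finset.mem_powersetCard]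

theorem card_spannedEdges_le {T : Finset V} (hT : T.card = 3) : (G.spannedEdges T).card ≤ 3 := by
  classical
  have h : G.spannedEdges T ⊆ T.offDiag.image Sym2.mk.uncurry := by
    intro e he
    induction e with
    | h a b =>
      simp only [spannedEdges, Finset.mem_filter, mem_edgeFinset, mem_edgeSet] at he
      exact Finset.mem_image.2 ⟨(a, b), Finset.mem_offDiag.2
        ⟨he.2 a (by simp), he.2 b (by simp), he.1.ne⟩, rfl⟩
  refine (Finset.card_le_card h).trans ?_
  have := Sym2.two_mul_card_image_offDiag T
  rw [Finset.offDiag_card, hT] at this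
  omega

theorem card_powersetCard_eq_sum_numTriples :
    ((Finset.univ : Finset V).powersetCard 3).card =
      G.numTriples 0 + G.numTriples 1 + G.numTriples 2 + G.numTriples 3 := by
  classical
  rw [Finset.card_eq_sum_card_fiberwise (f := fun T => (G.spannedEdges T).card)
    (t := Finset.range 4)]
  · simp only [← numTriples_eq, Finset.sum_range_succ, Finset.sum_range_zero, zero_add]
  · intro T hT
    have := G.card_spannedEdges_le (Finset.mem_powersetCard.1 (Finset.mem_coe.1 hT)).2
    simp only [Finset.coe_range, Set.mem_Iio]
    omega

theorem sum_card_spannedEdges :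
    ∑ T ∈ (Finset.univ : Finset V).powersetCard 3, (G.spannedEdges T).card =
      G.numTriples 1 + 2 * G.numTriples 2 + 3 * G.numTriples 3 := by
  classical
  rw [← Finset.sum_fiberwise_of_maps_to (g := fun T => (G.spannedEdges T).card)
    (t := Finset.range 4)]
  · have h (j : ℕ) : ∑ T ∈ (Finset.univ : Finset V).powersetCard 3 with
        (G.spannedEdges T).card = j, (G.spannedEdges T).card = j * G.numTriples j := by
      rw [Finset.sum_congr rfl fun T hT => (Finset.mem_filter.1 hT).2, Finset.sum_const,
        smul_eq_mul, numTriples_eq, mul_comm]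
    simp only [h, Finset.sum_range_succ, Finset.sum_range_zero]
    ring
  · intro T hT
    have := G.card_spannedEdges_le (Finset.mem_powersetCard.1 hT).2
    simp only [Finset.mem_range]
    omega

open Classical in
theorem card_triples_containing {a b : V} (hab : a ≠ b) :
    (((Finset.univ : Finset V).powersetCard 3).filter fun T => a ∈ T ∧ b ∈ T).card + 2 =
      Fintype.card V := by
  have h : ((Finset.univ : Finset V) \ {a, b}).card =
      (((Finset.univ : Finset V).powersetCard 3).filter fun T => a ∈ T ∧ b ∈ T).card := by
    refine Finset.card_bij (fun w _ => {a, b, w}) ?_ ?_ ?_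
    · intro w hw
      simp only [Finset.mem_sdiff, Finset.mem_univ, Finset.mem_insert, Finset.mem_singleton,
        true_and, not_or] at hw
      simp [Finset.mem_powersetCard, Finset.card_eq_three.2 ⟨a, b, w, hab, Ne.symm hw.1,
        Ne.symm hw.2, rfl⟩]
    · intro w hw w' hw' h
      simp only [Finset.mem_sdiff, Finset.mem_univ, Finset.mem_insert, Finset.mem_singleton,
        true_and, not_or] at hw
      have : w ∈ ({a, b, w'} : Finset V) := h ▸ (by simp)
      simpa [hw.1, hw.2] using this
    · intro T hT
      simp only [Finset.mem_filter, Finset.mem_powersetCard, Finset.subset_univ, true_and] at hT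
      obtain ⟨w, haw, hbw, hw⟩ := exists_isTriple_of_adj hT.1 hT.2.1 hT.2.2 hab
      exact ⟨w, by simp [haw.symm, hbw.symm], Finset.ext fun x => by simp [hw x]⟩
  rw [← h, ← Finset.card_univ, ← Finset.card_pair hab]
  exact Finset.card_sdiff_add_card_eq_card (Finset.subset_univ _)

theorem sum_card_spannedEdges_add :
    ∑ T ∈ (Finset.univ : Finset V).powersetCard 3, (G.spannedEdges T).card +
      2 * Nat.card G.edgeSet = Nat.card G.edgeSet * Fintype.card V := by
  classical
  have h := Finset.sum_card_bipartiteAbove_eq_sum_card_bipartiteBelow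
    (s := (Finset.univ : Finset V).powersetCard 3) (t := G.edgeFinset)
    (fun T e => ∀ x ∈ e, x ∈ T)
  have h1 : ∑ T ∈ (Finset.univ : Finset V).powersetCard 3, (G.spannedEdges T).card =
      ∑ e ∈ G.edgeFinset, (((Finset.univ : Finset V).powersetCard 3).bipartiteBelow
        (fun T e => ∀ x ∈ e, x ∈ T) e).card := h
  have h2 : ∀ e ∈ G.edgeFinset, (((Finset.univ : Finset V).powersetCard 3).bipartiteBelow
        (fun T e => ∀ x ∈ e, x ∈ T) e).card + 2 = Fintype.card V := by
    intro e he
    induction e with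
    | h a b =>
      rw [mem_edgeFinset, mem_edgeSet] at he
      rw [← card_triples_containing he.ne, Finset.bipartiteBelow]
      congr 2
      ext T
      simp
  have h3 : Nat.card G.edgeSet = G.edgeFinset.card := by
    rw [Nat.card_eq_fintype_card, edgeFinset_card]
  rw [h1, h3, ← smul_eq_mul G.edgeFinset.card, ← Finset.sum_const, ← Finset.sum_congr rfl h2,
    Finset.sum_add_distrib, Finset.sum_const, smul_eq_mul, mul_comm 2]

theorem card_stateRow_add [Fintype G.StateRow] :
    Fintype.card G.StateRow + Nat.card G.edgeSet = Nat.card G.edgeSet * Fintype.card V := by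
  classical
  have := Fintype.ofFinite G.edgeSet
  rw [← Nat.card_eq_fintype_card, Nat.card_sigma, Nat.card_eq_fintype_card,
    ← smul_eq_mul (Fintype.card G.edgeSet), ← Finset.card_univ, ← Finset.sum_const,
    Finset.card_eq_sum_ones, ← Finset.sum_add_distrib]
  refine Finset.sum_congr rfl fun e _ => ?_
  rw [Nat.card_eq_fintype_card, card_stateComp_singleton]

/-- The distance of two vertices is two if they are distinct, not adjacent and have a common
neighbour. -/
theorem dist_eq_two {a b : V} : G.dist a b = 2 ↔
    (a ≠ b ∧ ¬G.Adj a b) ∧ ∃ z, G.Adj a z ∧ G.Adj z b := by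
  rw [SimpleGraph.dist, ENat.toNat_eq_iff two_ne_zero]
  refine edist_eq_two_iff.trans ?_
  rw [and_assoc]
  refine and_congr_right fun _ => and_congr_right fun _ => ?_
  simp only [Set.Nonempty, mem_commonNeighbors, G.adj_comm b]

variable {G} {r : V → V → Prop}

open Classical in
theorem numPairsAtDistTwo_eq (hr : ∀ a b, a ≠ b → (r a b ↔ ¬r b a)) :
    G.numPairsAtDistTwo =
      2 * (Finset.univ.filter fun p : V × V => G.dist p.1 p.2 = 2 ∧ r p.1 p.2).card := by
  have h1 : G.numPairsAtDistTwo =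
      (Finset.univ.filter fun p : V × V => G.dist p.1 p.2 = 2).card := by
    rw [numPairsAtDistTwo, ← Set.ncard_coe_finset]
    congr 1
    ext p
    simp
  have h2 : (Finset.univ.filter fun p : V × V => G.dist p.1 p.2 = 2 ∧ ¬r p.1 p.2).card =
      (Finset.univ.filter fun p : V × V => G.dist p.1 p.2 = 2 ∧ r p.1 p.2).card := by
    refine Finset.card_equiv (Equiv.prodComm V V) fun p => ?_
    simp only [Finset.mem_filter, Finset.mem_univ, true_and, Equiv.prodComm_apply, Prod.fst_swap,
      Prod.snd_swap, dist_comm (u := p.2)]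
    refine and_congr_right fun h => ?_
    rw [hr p.2 p.1 (G.dist_eq_two.1 h).1.1.symm]
  rw [h1, ← Finset.card_filter_add_card_filter_not (fun p : V × V => r p.1 p.2),
    Finset.filter_filter, Finset.filter_filter, h2, two_mul]

open Classical in
theorem card_dart_eq : (Finset.univ.filter fun p : V × V => G.Adj p.1 p.2).card =
    2 * Nat.card G.edgeSet := by
  rw [Nat.card_eq_fintype_card, ← edgeFinset_card, ← dart_card_eq_twice_card_edges,
    ← Finset.card_univ]
  symm
  refine Finset.card_bij (fun d _ => d.toProd) (fun d _ => by simp)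
    (fun d _ d' _ h => Dart.ext _ _ h) fun p hp => ?_
  exact ⟨⟨p, (Finset.mem_filter.1 hp).2⟩, Finset.mem_univ _, rfl⟩

theorem card_free_index (hr : ∀ a b, a ≠ b → (r a b ↔ ¬r b a)) [Fintype (FreeIndex G r)]
    [Fintype (StateCol V)] :
    2 * Fintype.card (FreeIndex G r) + 2 * G.numTriples 1 + 2 * G.numTriples 2 +
      2 * G.numTriples 3 + G.numPairsAtDistTwo + 4 * Nat.card G.edgeSet =
        2 * Fintype.card (StateCol V) := by
  classical
  have hT : Nat.card {T : {T : Finset V // T.card = 3} // ∀ a ∈ T.1, ∀ b ∈ T.1, ¬G.Adj a b} =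
      G.numTriples 0 := by
    rw [Nat.card_congr (Equiv.subtypeSubtypeEquivSubtypeInter (fun T : Finset V => T.card = 3)
      fun T => ∀ a ∈ T, ∀ b ∈ T, ¬G.Adj a b), numTriples, ← Nat.card_coe_set_eq]
    refine Nat.card_congr (Equiv.subtypeEquivRight fun T => and_congr_right fun _ => ?_)
    rw [ncard_spannedEdges, Finset.card_eq_zero, Finset.eq_empty_iff_forall_notMem]
    constructor
    · intro h e he
      induction e with
      | h a b =>
        simp only [spannedEdges, Finset.mem_filter, mem_edgeFinset, mem_edgeSet] at he
        exact h a (he.2 a (by simp)) b (he.2 b (by simp)) he.1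
    · intro h a ha b hb hab
      exact h s(a, b) (by simp [spannedEdges, hab, ha, hb])
  have hP : Nat.card {p : V × V // (p.1 ≠ p.2 ∧ ¬G.Adj p.1 p.2) ∧
      ((∃ z, G.Adj p.1 z ∧ G.Adj z p.2) → r p.1 p.2)} =
      (Finset.univ.filter fun p : V × V => (p.1 ≠ p.2 ∧ ¬G.Adj p.1 p.2) ∧
        ((∃ z, G.Adj p.1 z ∧ G.Adj z p.2) → r p.1 p.2)).card := by
    rw [Nat.card_eq_fintype_card, Fintype.card_subtype]
  have hC1 : Nat.card {T : Finset V // T.card = 3} =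
      ((Finset.univ : Finset V).powersetCard 3).card := by
    rw [Nat.card_eq_fintype_card, Fintype.card_subtype]
    congr 1
    ext T
    simp [Finset.mem_powersetCard]
  have hC2 : Nat.card {p : V × V // p.1 ≠ p.2} =
      (Finset.univ.filter fun p : V × V => p.1 ≠ p.2).card := by
    rw [Nat.card_eq_fintype_card, Fintype.card_subtype]
  have h1 := Finset.card_filter_add_card_filter_not
    (s := Finset.univ.filter fun p : V × V => p.1 ≠ p.2) (fun p : V × V => G.Adj p.1 p.2)
  rw [Finset.filter_filter, Finset.filter_filter] at h1
  have h2 := Finset.card_filter_add_card_filter_not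
    (s := Finset.univ.filter fun p : V × V => p.1 ≠ p.2 ∧ ¬G.Adj p.1 p.2)
    (fun p : V × V => (∃ z, G.Adj p.1 z ∧ G.Adj z p.2) → r p.1 p.2)
  rw [Finset.filter_filter, Finset.filter_filter] at h2
  have h3 : (Finset.univ.filter fun p : V × V => p.1 ≠ p.2 ∧ G.Adj p.1 p.2) =
      Finset.univ.filter fun p : V × V => G.Adj p.1 p.2 :=
    Finset.filter_congr fun p _ => ⟨And.right, fun h => ⟨h.ne, h⟩⟩
  have h4 : (Finset.univ.filter fun p : V × V => (p.1 ≠ p.2 ∧ ¬G.Adj p.1 p.2) ∧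
      ¬((∃ z, G.Adj p.1 z ∧ G.Adj z p.2) → r p.1 p.2)).card =
      (Finset.univ.filter fun p : V × V => G.dist p.1 p.2 = 2 ∧ r p.1 p.2).card := by
    refine Finset.card_equiv (Equiv.prodComm V V) fun p => ?_
    simp only [Finset.mem_filter, Finset.mem_univ, true_and, Equiv.prodComm_apply, Prod.fst_swap,
      Prod.snd_swap, dist_comm (u := p.2)]
    rw [dist_eq_two, Classical.not_imp, ← and_assoc]
    refine and_congr_right fun h => ?_
    rw [hr p.2 p.1 h.1.1.symm]
  rw [h3, card_dart_eq] at h1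
  rw [h4] at h2
  have h5 := numPairsAtDistTwo_eq (G := G) hr
  have h6 := G.card_powersetCard_eq_sum_numTriples
  rw [← Nat.card_eq_fintype_card, ← Nat.card_eq_fintype_card (α := StateCol V), Nat.card_sum,
    Nat.card_sum, hT, hP, hC1, hC2]
  omega

end Counting

end SimpleGraph

namespace SimpleGraph

section Final

theorem exists_total_order (V : Type u) :
    ∃ r : V → V → Prop, ∀ a b, a ≠ b → (r a b ↔ ¬r b a) := by
  refine ⟨WellOrderingRel, fun a b h => ⟨fun h1 h2 => asymm h1 h2, fun h1 => ?_⟩⟩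
  rcases trichotomous_of WellOrderingRel a b with h2 | h2 | h2
  exacts [h2, absurd h2 h, absurd h2 h1]

theorem six_nsmul_eq_zero {c k n : ℕ} {x : (Fin c → ℤ) × (Fin k → ZMod 2) × (Fin n → ZMod 3)}
    (h : 9 • x = 0) : 6 • x = 0 := by
  obtain ⟨x, y, z⟩ := x
  have h' : (9 : ℕ) • x = 0 := congrArg Prod.fst h
  have hx : x = 0 := (smul_eq_zero.1 h').resolve_left (by norm_num)
  subst hx
  refine Prod.ext (smul_zero 6 : (6 : ℕ) • (0 : Fin c → ℤ) = 0) (Prod.ext (funext fun i => ?_) (funext fun i => ?_))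
  · change 6 • y i = 0
    rw [nsmul_eq_mul]
    exact zero_mul _
  · change 6 • z i = 0
    rw [nsmul_eq_mul]
    exact zero_mul _

theorem numTriangleComponents_eq {V : Type u} [Finite V] (G : SimpleGraph V) :
    G.numTriangleComponents = G.numCoherentComponents +
      Nat.card {C : G.triangleGraph.ConnectedComponent // ¬G.IsCoherent C} := by
  classical
  rw [numTriangleComponents, numCoherentComponents, ← Nat.card_sum]
  exact Nat.card_congr (Equiv.sumCompl _).symm

end Final

end SimpleGraph
end

theorem corollary4p8 {V : Type*} [Finite V] (G : SimpleGraph V)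
    (num : G.edgeSet ≃ Fin (Nat.card G.edgeSet)) (hconn : G.Connected) (hsq : G.IsSquareCordial)
    (htri : ∀ a b : V, G.Adj a b → ∃ c : V, G.Adj a c ∧ G.Adj b c) :
    ∃ n₂ n₃ r : ℕ,
      (n₂ : ℤ) = G.numTriangleComponents - G.numCoherentComponents ∧
      (n₃ : ℤ) = Nat.card V - 1 + Module.finrank (ZMod 3) (G.hatX₃.H₁ (ZMod 3))
        - G.numCoherentComponents ∧
      (r : ℚ) = G.numCoherentComponents + G.numTriples 2 + 2 * G.numTriples 3
        - Nat.card G.edgeSet - (G.numPairsAtDistTwo : ℚ) / 2 ∧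
      Nonempty (G.XΔ.H₁ ℤ ≃+
        (Fin G.numCoherentComponents → ℤ) × (Fin n₂ → ZMod 2) × (Fin n₃ → ZMod 3)) ∧
      (∀ z : G.XΔ.H₁ ℤ, addOrderOf z ≠ 9) ∧
      Nonempty (G.chromaticCohomology num 3 1 (2 * (Nat.card V : ℤ) - 3) ≃+
        (Fin n₂ → ZMod 2) × (Fin n₃ → ZMod 3) × (Fin r → ℤ)) := by
  classical
  have := Fintype.ofFinite V
  have : Fintype (SimpleGraph.StateCol V) := Fintype.ofFinite _
  have := Fintype.ofFinite G.edgeSet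
  obtain ⟨n, ⟨e⟩⟩ := G.edgeGroup_structure htri
  set k := Nat.card {C : G.triangleGraph.ConnectedComponent // ¬G.IsCoherent C}
  obtain ⟨ord, hord⟩ := SimpleGraph.exists_total_order V
  obtain ⟨g⟩ := SimpleGraph.dualCoker_equiv hord hsq
  have := Fintype.ofFinite (SimpleGraph.FreeIndex G ord)
  let eB : G.DualCoker ≃+ (Fin (G.numCoherentComponents +
      Fintype.card (SimpleGraph.FreeIndex G ord)) → ℤ) × (Fin k → ZMod 2) × (Fin n → ZMod 3) :=
    g.trans ((e.prodCongr (LinearEquiv.funCongrLeft ℤ ℤ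
      (Fintype.equivFin (SimpleGraph.FreeIndex G ord)).symm).toAddEquiv).trans
      { toFun := fun x => (Fin.append x.1.1 x.2, x.1.2)
        invFun := fun y => ((fun i => y.1 (Fin.castAdd _ i), y.2), fun i => y.1 (Fin.natAdd _ i))
        left_inv := fun x => by simp
        right_inv := fun y => by simp [Fin.append_castAdd_natAdd]
        map_add' := fun x y => Prod.ext (funext fun i => by
          refine Fin.addCases (fun i => ?_) (fun i => ?_) i <;> simp) rfl })
  obtain ⟨r, hr, ⟨eA⟩⟩ := coker_transpose G.stateMatrix eB
  have hN : 1 ≤ Nat.card V := by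
    have := hconn.nonempty
    exact Nat.card_pos
  refine ⟨k, n, r, ?_, ?_, ?_, ⟨G.H₁EquivEdgeGroup.trans e⟩, fun z hz => ?_,
    ⟨(SimpleGraph.chromaticCohomologyEquiv num).trans (eA.trans AddEquiv.prodAssoc)⟩⟩
  · rw [G.numTriangleComponents_eq]
    push_cast
    ring
  · have h1 := SimpleGraph.finrank_chainQuotient_eq e
    have h2 := SimpleGraph.finrank_chainQuotient hconn
    omega
  · have h1 := SimpleGraph.card_free_index (G := G) hord
    have h2 := G.card_stateRow_add
    have h3 := G.sum_card_spannedEdges_add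
    rw [G.sum_card_spannedEdges] at h3
    have h4 : 2 * r + 2 * Nat.card G.edgeSet + G.numPairsAtDistTwo =
        2 * G.numCoherentComponents + 2 * G.numTriples 2 + 4 * G.numTriples 3 := by omega
    have h5 : (2 * r + 2 * Nat.card G.edgeSet + G.numPairsAtDistTwo : ℚ) =
        2 * G.numCoherentComponents + 2 * G.numTriples 2 + 4 * G.numTriples 3 := by
      exact_mod_cast h4
    linarith
  · have h9 : 9 • z = 0 := by rw [← hz, addOrderOf_nsmul_eq_zero]
    let f := G.H₁EquivEdgeGroup.trans e
    have h6 : 6 • f z = 0 := SimpleGraph.six_nsmul_eq_zero (by rw [← map_nsmul, h9, map_zero])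
    rw [← map_nsmul, f.map_eq_zero_iff] at h6
    have := addOrderOf_dvd_of_nsmul_eq_zero h6
    rw [hz] at this
    norm_num at this
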